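/- \textbf{Theorem (Scale invariant t-test extended martingale).} Let $X_1,X_2,\dots$ be real random variables and put $S_n=\sum_{i\le n}X_i$, $V_n=\sum_{i\le n}X_i^2$. Call a measurable function $f:\mathbb R^n\to\mathbb R$ scale invariant if $f(\lambda x)=f(x)$ for all $\lambda>0$, and let $\mathcal F_n^*=\sigma\big(f(X_1,\dots,X_n): f \text{ scale invariant}\big)$. A $[0,\infty]$-valued process $(M_n)_{n\ge n_0}$ is an extended nonnegative supermartingale (ENSM) for $P$ on a filtration $(\mathcal G_n)$ if each $M_n$ is $\mathcal G_n$-measurable and $E_P(M_{n+1}\mid\mathcal G_n)\le M_n$ almost surely for all $n\ge n_0$, with no integrability required; it is a nonnegative martingale (NM) if equality holds and $E_P(M_{n_0})<\infty$. Define $$H_1=\infty,\qquad H_n=\sqrt{\frac{2\pi}{n}}\left(\frac{nV_n}{nV_n-S_n^2}\right)^{n/2}\ (n\ge2),\qquad h_{\theta,n}=\frac{e^{-n\theta^2/2}}{\Gamma(n/2)}\int_0^\infty y^{n/2-1}\exp\Big\{-y+\theta S_n\sqrt{2y/V_n}\Big\}\,dy .$$ (1) If $X_1,X_2,\dots$ are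 i.i.d. $N(0,\sigma^2)$ with $\sigma>0$, then $(H_n)_{n\ge1}$ is an ENSM on $(\mathcal F_n^*)_{n\ge1}$. It is the flat (improper) mixture of the processes $(h_{\theta,n})_{n\ge1}$, $\theta\in\mathbb R$, each of which is an NM on $(\mathcal F^*_n)_{n\ge1}$: for every $n\ge1$, almost surely $H_n=\int_{\mathbb R}h_{\theta,n}\,d\theta$. It satisfies the extended Ville inequality: for every $m\ge1$ and $0<\varepsilon<\infty$, $$P(\exists n\ge m,\ H_n\ge\varepsilon)\le \varepsilon^{-1}E\big(\mathbf 1_{\{H_m<\varepsilon\}}H_m\big)+P(H_m\ge\varepsilon).$$ (2) (Lai's t-confidence sequence, obtained by applying this inequality.) Let $m\ge2$ be an integer and $a>0$, let $\overline X_n=S_n/n$, $s_n^2=\frac1n\sum_{i\le n}(X_i-\overline X_n)^2$, and $$b=\frac1m\Big(1+\frac{a^2}{m-1}\Big)^m,\qquad \xi_n=\sqrt{s_n^2\big[(bn)^{1/n}-1\big]},\qquad \mathrm{CI}_n=[\overline X_n-\xi_n,\ \overline X_n+\xi_n].$$ Let $X_1,X_2,\dots$ be i.i.d. $N(\mu,\sigma^2)$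 with $\mu\in\mathbb R$, $\sigma>0$, let $H_n^\mu$ be $H_n$ computed from the data $X_i-\mu$, and let $F_{m-1},f_{m-1}$ be the distribution function and the density of Student's t-distribution with $m-1$ degrees of freedom. Then for $n\ge m$ one has $\mu\notin\mathrm{CI}_n$ if and only if $H_n^\mu>\varepsilon:=\sqrt{2\pi b}$ (with the quotient in $H_n^\mu$ read as $c/0=\infty$ for $c>0$ and $0/0=0$), and $$P(\exists n\ge m,\ \mu\notin \mathrm{CI}_n)\le \varepsilon^{-1}E\big(\mathbf 1_{\{H^\mu_m<\varepsilon\}}H^\mu_m\big)+P(H^\mu_m\ge\varepsilon)\le 2\big(1-F_{m-1}(a)+a f_{m-1}(a)\big).$$ -/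

import Mathlib

open MeasureTheory ProbabilityTheory
open scoped ENNReal NNReal

namespace TTest

/-- The processes of this file are functions of a data stream. The observations `X₁, X₂, …` are
`x 0, x 1, …`, so that the first `n` observations are `x i` with `i < n`. Partial sum `Sₙ`. -/
noncomputable def pSum (n : ℕ) (x : ℕ → ℝ) : ℝ := ∑ i ∈ Finset.range n, x i

/-- Partial sum of squares `Vₙ`. -/
noncomputable def pSumSq (n : ℕ) (x : ℕ → ℝ) : ℝ := ∑ i ∈ Finset.range n, x i ^ 2

/-- Sample average. -/
noncomputable def avg (n : ℕ) (x : ℕ → ℝ) : ℝ := pSum n x / n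

/-- Sample variance `sₙ²` (without Bessel's correction). -/
noncomputable def sampleVar (n : ℕ) (x : ℕ → ℝ) : ℝ :=
  (∑ i ∈ Finset.range n, (x i - avg n x) ^ 2) / n

/-- A measurable function on `ℝⁿ` that does not change under rescaling by a positive constant. -/
def IsScaleInvariant {n : ℕ} (f : (Fin n → ℝ) → ℝ) : Prop :=
  Measurable f ∧ ∀ (c : ℝ), 0 < c → ∀ x : Fin n → ℝ, f (fun i => c * x i) = f x

/-- The σ-algebra `Fₙ* = σ(f(X₁, …, Xₙ) : f is scale invariant)`. -/
@[reducible]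
def scaleInvSigma {Ω : Type*} (X : ℕ → Ω → ℝ) (n : ℕ) : MeasurableSpace Ω :=
  ⨆ (f : (Fin n → ℝ) → ℝ) (_ : IsScaleInvariant f),
    MeasurableSpace.comap (fun ω => f (fun i => X i ω)) inferInstance

/-- The scale invariant filtration of the data `X`. -/
def scaleInvFiltration {Ω : Type*} [mΩ : MeasurableSpace Ω] (X : ℕ → Ω → ℝ)
    (hX : ∀ i, Measurable (X i)) : Filtration ℕ mΩ where
  seq := scaleInvSigma X
  mono' := by
    refine monotone_nat_of_le_succ fun n => ?_
    refine iSup₂_le fun f hf => ?_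
    have hg : IsScaleInvariant (fun x : Fin (n + 1) → ℝ => f (fun i => x i.castSucc)) :=
      ⟨hf.1.comp (by fun_prop), fun c hc x => hf.2 c hc (fun i => x i.castSucc)⟩
    exact le_iSup₂_of_le (f := fun (g : (Fin (n + 1) → ℝ) → ℝ) (_ : IsScaleInvariant g) =>
      MeasurableSpace.comap (fun ω => g (fun i => X i ω)) inferInstance) _ hg le_rfl
  le' := by
    intro n
    refine iSup₂_le fun f hf => ?_
    exact (hf.1.comp (measurable_pi_lambda _ fun i => hX i)).comap_le

/-- The process `(Mₙ)`, `n ≥ n₀`, is an extended nonnegative supermartingale for `P` on `G`: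
it is adapted and `E[Mₙ₊₁ | Gₙ] ≤ Mₙ` almost surely. No integrability is required; the
conditional expectation is that of `[0, ∞]`-valued functions. -/
structure IsENSM {Ω : Type*} [mΩ : MeasurableSpace Ω] (P : Measure Ω) (G : Filtration ℕ mΩ)
    (n₀ : ℕ) (M : ℕ → Ω → ℝ≥0∞) : Prop where
  adapted : ∀ n, n₀ ≤ n → Measurable[G n] (M n)
  condExp_le : ∀ n, n₀ ≤ n → condLExp (G n) P (M (n + 1)) ≤ᵐ[P] M n

/-- The process `(Mₙ)`, `n ≥ n₀`, is a nonnegative martingale for `P` on `G`. -/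
structure IsNM {Ω : Type*} [mΩ : MeasurableSpace Ω] (P : Measure Ω) (G : Filtration ℕ mΩ)
    (n₀ : ℕ) (M : ℕ → Ω → ℝ≥0∞) : Prop where
  integrable : ∫⁻ ω, M n₀ ω ∂P < ∞
  adapted : ∀ n, n₀ ≤ n → Measurable[G n] (M n)
  condExp_eq : ∀ n, n₀ ≤ n → condLExp (G n) P (M (n + 1)) =ᵐ[P] M n

/-- The bound of the extended Ville inequality, for the process started at time `m` and
the level `ε`: `ε⁻¹ E[1_{M_m < ε} M_m] + P(M_m ≥ ε)`. -/
noncomputable def villeBound {Ω : Type*} [MeasurableSpace Ω] (P : Measure Ω)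
    (M : ℕ → Ω → ℝ≥0∞) (m : ℕ) (ε : ℝ≥0∞) : ℝ≥0∞ :=
  ε⁻¹ * ∫⁻ ω in {ω | M m ω < ε}, M m ω ∂P + P {ω | ε ≤ M m ω}

/-- Under `P`, the sequence `X` is i.i.d. `N(μ, v)`, where `v` is the variance. -/
structure IsIIDGaussian {Ω : Type*} [MeasurableSpace Ω] (P : Measure Ω) (X : ℕ → Ω → ℝ)
    (μ : ℝ) (v : ℝ≥0) : Prop where
  indep : iIndepFun X P
  law : ∀ i, HasLaw (X i) (gaussianReal μ v) P

/-- The process `Hₙ = √(2π/n) (n Vₙ / (n Vₙ - Sₙ²))^{n/2}` for `n ≥ 2`, and `H₁ = ∞`. The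
quotient is taken in `[0, ∞]`, so that `c / 0 = ∞` for `c > 0`. -/
noncomputable def tENSM (n : ℕ) (x : ℕ → ℝ) : ℝ≥0∞ :=
  if n ≤ 1 then ∞ else
    ENNReal.ofReal (Real.sqrt (2 * Real.pi / n)) *
      (ENNReal.ofReal (n * pSumSq n x) / ENNReal.ofReal (n * pSumSq n x - pSum n x ^ 2))
        ^ ((n : ℝ) / 2)

/-- The scale invariant t-likelihood ratio
`h_{θ,n} = e^{-nθ²/2} / Γ(n/2) ∫_{y > 0} y^{n/2-1} exp(-y + θ Sₙ √(2y/Vₙ)) dy`. -/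
noncomputable def tLR (θ : ℝ) (n : ℕ) (x : ℕ → ℝ) : ℝ≥0∞ :=
  ENNReal.ofReal (Real.exp (-(n * θ ^ 2 / 2)) / Real.Gamma ((n : ℝ) / 2)) *
    ∫⁻ y in Set.Ioi (0 : ℝ), ENNReal.ofReal
      (y ^ ((n : ℝ) / 2 - 1) * Real.exp (-y + θ * pSum n x * Real.sqrt (2 * y / pSumSq n x)))

/-- Density of Student's t-distribution with `k` degrees of freedom. -/
noncomputable def tPDF (k t : ℝ) : ℝ :=
  Real.Gamma ((k + 1) / 2) / (Real.sqrt (k * Real.pi) * Real.Gamma (k / 2)) *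
    (1 + t ^ 2 / k) ^ (-((k + 1) / 2))

/-- Distribution function of Student's t-distribution with `k` degrees of freedom. -/
noncomputable def tCDF (k a : ℝ) : ℝ := ∫ t in Set.Iic a, tPDF k t

/-- The constant `b = (1/m) (1 + a²/(m-1))^m`. -/
noncomputable def laiB (m : ℕ) (a : ℝ) : ℝ := 1 / m * (1 + a ^ 2 / ((m : ℝ) - 1)) ^ m

/-- The radius `ξₙ = √(sₙ² [(b n)^{1/n} - 1])`. -/
noncomputable def laiRadius (m : ℕ) (a : ℝ) (n : ℕ) (x : ℕ → ℝ) : ℝ :=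
  Real.sqrt (sampleVar n x * ((laiB m a * n) ^ (1 / (n : ℝ)) - 1))

/-- Lai's interval: sample average plus or minus the radius. -/
noncomputable def laiCI (m : ℕ) (a : ℝ) (n : ℕ) (x : ℕ → ℝ) : Set ℝ :=
  Set.Icc (avg n x - laiRadius m a n x) (avg n x + laiRadius m a n x)

end TTest

/-! A set of the scale invariant σ-algebra is an event "(X₁, …, Xₙ) ∈ A" with `A` a measurable cone,
that is, stable under positive rescaling. The probability of such an event does not depend on the
variance, so `N(0, v)ⁿ` may be replaced by the standard Gaussian `stdGauss n`. Under `stdGauss n`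
the direction of the vector is independent of its length, and half the squared length has the Gamma
law with parameter n/2. Averaging a function along each ray with this law therefore preserves its
integral over every cone (`lintegral_mul_radialAvg`).

The process `h_θ` is the radial average of the likelihood ratio of `N(θ, 1)ⁿ` against `N(0, 1)ⁿ`, so
its integral over the event of a cone `A` is `N(θ, 1)ⁿ(A)` (`IsIIDGaussian.setLIntegral_tLR`). The
consistency of product measures gives the martingale property. Integrating over `θ`, a Gaussian
integral followed by a Gamma integral, produces `H` (`lintegral_radialAvg_shiftLR`). By Tonelli, `H`
inherits the equality of integrals over sets of the filtration. No finiteness is used, which is why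
only an extended supermartingale results.

The extended Ville inequality `IsENSM.ville` stops the process at its first passage of the level;
the mass at or above the level at the starting time is paid for separately by its probability.

For Lai's sequence, `H` at time m = k + 1 is a function of the t-statistic `u` that is inversely
proportional to the Student density `f` with `k` degrees of freedom. At the level H(a), the
integrand f(u) H(u) / H(a) is the constant f(a) on (-a, a). This contributes 2 a f(a), the tails
contribute 2 (1 - F(a)), and the final bound is in fact an equality
(`IsIIDGaussian.villeBound_tENSM_eq`). -/

namespace TTest

/-! ### Scale invariant events as cones -/

/-- The σ-algebra of measurable sets that are stable under positive rescaling. -/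
@[reducible]
def coneSigma (n : ℕ) : MeasurableSpace (Fin n → ℝ) where
  MeasurableSet' A := MeasurableSet A ∧
    ∀ c : ℝ, 0 < c → ∀ x : Fin n → ℝ, (fun i => c * x i) ∈ A ↔ x ∈ A
  measurableSet_empty := ⟨MeasurableSet.empty, by simp⟩
  measurableSet_compl A hA := ⟨hA.1.compl, fun c hc x => not_congr (hA.2 c hc x)⟩
  measurableSet_iUnion f hf := ⟨MeasurableSet.iUnion fun i => (hf i).1, fun c hc x => by
    simp only [Set.mem_iUnion]
    exact exists_congr fun i => (hf i).2 c hc x⟩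

lemma IsScaleInvariant.measurable_coneSigma {n : ℕ} {f : (Fin n → ℝ) → ℝ}
    (hf : IsScaleInvariant f) : Measurable[coneSigma n] f := fun s hs =>
  ⟨hf.1 hs, fun c hc x => by simp only [Set.mem_preimage, hf.2 c hc x]⟩

/-- The indicator of a measurable cone is itself scale invariant, so the supremum of the generated
σ-algebras is already a single pullback. -/
lemma scaleInvSigma_eq_comap {Ω : Type*} (X : ℕ → Ω → ℝ) (n : ℕ) :
    scaleInvSigma X n = (coneSigma n).comap (fun ω (i : Fin n) => X i ω) := by
  apply le_antisymm
  · refine iSup₂_le fun f hf => ?_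
    have h := hf.measurable_coneSigma
    rw [show (fun ω => f (fun i => X i ω)) = f ∘ (fun ω (i : Fin n) => X i ω) from rfl,
      ← MeasurableSpace.comap_comp]
    exact MeasurableSpace.comap_mono h.comap_le
  · rintro _ ⟨A, hA, rfl⟩
    classical
    have hf : IsScaleInvariant (A.indicator (fun _ => (1 : ℝ))) :=
      ⟨measurable_const.indicator hA.1, fun c hc x => by
        simp only [Set.indicator_apply, hA.2 c hc x]⟩
    refine (le_iSup₂_of_le (f := fun (g : (Fin n → ℝ) → ℝ) (_ : IsScaleInvariant g) =>
      MeasurableSpace.comap (fun ω => g (fun i => X i ω)) inferInstance) _ hf le_rfl) _ ?_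
    refine ⟨{1}, measurableSet_singleton _, ?_⟩
    ext ω
    simp [Set.indicator_apply]

lemma measurable_scaleInvSigma {Ω : Type*} (X : ℕ → Ω → ℝ) {n : ℕ} {M : (Fin n → ℝ) → ℝ≥0∞}
    (hM : Measurable M)
    (hinv : ∀ c : ℝ, 0 < c → ∀ x : Fin n → ℝ, M (fun i => c * x i) = M x) :
    Measurable[scaleInvSigma X n] (fun ω => M (fun i => X i ω)) := by
  rw [scaleInvSigma_eq_comap]
  have h : Measurable[coneSigma n] M := fun s hs =>
    ⟨hM hs, fun c hc x => by simp only [Set.mem_preimage, hinv c hc x]⟩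
  exact h.comp (comap_measurable _)

lemma exists_cone_of_measurableSet {Ω : Type*} {X : ℕ → Ω → ℝ} {n : ℕ} {s : Set Ω}
    (hs : MeasurableSet[scaleInvSigma X n] s) :
    ∃ A : Set (Fin n → ℝ), MeasurableSet A ∧
      (∀ c : ℝ, 0 < c → ∀ x : Fin n → ℝ, (fun i => c * x i) ∈ A ↔ x ∈ A) ∧
      s = (fun ω (i : Fin n) => X i ω) ⁻¹' A := by
  rw [scaleInvSigma_eq_comap] at hs
  obtain ⟨A, hA, rfl⟩ := hs
  exact ⟨A, hA.1, hA.2, rfl⟩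

/-! ### Extended Ville inequality -/

/-- The extended Ville inequality for extended nonnegative supermartingales. -/
theorem IsENSM.ville {Ω : Type*} [mΩ : MeasurableSpace Ω] {P : Measure Ω} [IsProbabilityMeasure P]
    {G : Filtration ℕ mΩ} {n₀ : ℕ} {M : ℕ → Ω → ℝ≥0∞} (hM : IsENSM P G n₀ M) {m : ℕ}
    (hm : n₀ ≤ m) {ε : ℝ≥0∞} (h0 : ε ≠ 0) (htop : ε ≠ ∞) :
    P {ω | ∃ n, m ≤ n ∧ ε ≤ M n ω} ≤ villeBound P M m ε := by
  let C : ℕ → Set Ω := fun N => {ω | ∀ j, m ≤ j → j ≤ m + N → M j ω < ε}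
  have hCG : ∀ N, MeasurableSet[G (m + N)] (C N) := by
    intro N
    have : C N = ⋂ j ∈ Finset.Icc m (m + N), {ω | M j ω < ε} := by
      ext ω; simp [C]
    rw [this]
    refine Finset.measurableSet_biInter _ fun j hj => ?_
    rw [Finset.mem_Icc] at hj
    exact G.mono hj.2 _ (hM.adapted j (hm.trans hj.1) measurableSet_Iio)
  have hC : ∀ N, MeasurableSet (C N) := fun N => G.le _ _ (hCG N)
  have hMm : ∀ n, n₀ ≤ n → Measurable (M n) := fun n hn => (hM.adapted n hn).mono (G.le n) le_rfl
  have hanti : Antitone C := fun a b hab ω hω j h1 h2 => hω j h1 (by omega)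
  have hC0 : C 0 = {ω | M m ω < ε} := by
    ext ω
    exact ⟨fun h => h m le_rfl le_rfl, fun h j h1 h2 => by
      obtain rfl : j = m := by omega
      exact h⟩
  -- The value of the process stopped at first passage, with `ε` as a lower bound for the value at
  -- passage. Points of `C N \ C (N + 1)` cross exactly at time m + N + 1; on `C N` the
  -- supermartingale inequality applies because `C N` is known at time m + N.
  have hstep : ∀ N, ε * P (C 0 \ C N) + ∫⁻ ω in C N, M (m + N) ω ∂P ≤ ∫⁻ ω in C 0, M m ω ∂P := by
    intro N
    induction N with
    | zero => simp
    | succ N ih =>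
      refine le_trans ?_ ih
      have hsub : C (N + 1) ⊆ C N := hanti (Nat.le_succ N)
      have h1 : P (C 0 \ C (N + 1)) = P (C 0 \ C N) + P (C N \ C (N + 1)) := by
        rw [← measure_union _ ((hC _).diff (hC _))]
        · congr 1
          have := hanti (Nat.zero_le N)
          ext ω
          simp only [Set.mem_sdiff, Set.mem_union]
          have := @this ω
          have := @hsub ω
          tauto
        · rw [Set.disjoint_left]
          rintro ω ⟨_, h⟩ ⟨h', _⟩
          exact h h'
      have h2 : ε * P (C N \ C (N + 1)) ≤ ∫⁻ ω in C N \ C (N + 1), M (m + (N + 1)) ω ∂P := by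
        rw [← setLIntegral_const]
        refine setLIntegral_mono (hMm _ (by omega)) fun ω hω => ?_
        by_contra hlt
        refine hω.2 fun j h1 h2 => ?_
        rcases Nat.lt_or_ge (m + N) j with h | h
        · obtain rfl : j = m + (N + 1) := by omega
          exact not_le.mp hlt
        · exact hω.1 j h1 h
      have h3 : ∫⁻ ω in C N, M (m + (N + 1)) ω ∂P ≤ ∫⁻ ω in C N, M (m + N) ω ∂P := by
        rw [← add_assoc, ← setLIntegral_condLExp (G.le (m + N)) P _ (hCG N)]
        exact lintegral_mono_ae (ae_restrict_of_ae (hM.condExp_le _ (by omega)))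
      have h4 : ∫⁻ ω in C N, M (m + (N + 1)) ω ∂P = ∫⁻ ω in C N \ C (N + 1), M (m + (N + 1)) ω ∂P
          + ∫⁻ ω in C (N + 1), M (m + (N + 1)) ω ∂P := by
        rw [← lintegral_union (hC _) Set.disjoint_sdiff_left, Set.sdiff_union_of_subset hsub]
      rw [h1, mul_add, add_assoc]
      gcongr
      exact (add_le_add_left h2 _).trans (h4 ▸ h3)
  have hlim : ε * P (C 0 \ ⋂ N, C N) ≤ ∫⁻ ω in C 0, M m ω ∂P := by
    have hmono : Monotone fun N => C 0 \ C N := fun a b hab => Set.sdiff_subset_sdiff_right (hanti hab)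
    rw [Set.sdiff_iInter, hmono.measure_iUnion, ENNReal.mul_iSup]
    exact iSup_le fun N => le_self_add.trans (hstep N)
  have hcover : {ω | ∃ n, m ≤ n ∧ ε ≤ M n ω} ⊆ (C 0 \ ⋂ N, C N) ∪ {ω | ε ≤ M m ω} := by
    rintro ω ⟨n, hn, hω⟩
    by_cases h : ε ≤ M m ω
    · exact Or.inr h
    · refine Or.inl ⟨hC0 ▸ not_le.mp h, fun hall => ?_⟩
      exact absurd (Set.mem_iInter.mp hall n n hn (by omega)) (not_lt.mpr hω)
  refine (measure_mono hcover).trans ((measure_union_le _ _).trans ?_)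
  rw [villeBound, ← hC0]
  gcongr
  rw [← ENNReal.div_eq_inv_mul, ENNReal.le_div_iff_mul_le (Or.inl h0) (Or.inl htop), mul_comm]
  exact hlim

/-! ### Changes of variable and Gaussian product densities -/

lemma lintegral_Ioi_inversion {c : ℝ} (hc : 0 < c) (f : ℝ → ℝ≥0∞) :
    ∫⁻ u in Set.Ioi (0 : ℝ), f u =
      ∫⁻ t in Set.Ioi (0 : ℝ), ENNReal.ofReal (c / t ^ 2) * f (c / t) := by
  have himg : (fun t : ℝ => c / t) '' Set.Ioi 0 = Set.Ioi 0 := by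
    ext u
    simp only [Set.mem_image, Set.mem_Ioi]
    constructor
    · rintro ⟨t, ht, rfl⟩
      positivity
    · intro hu
      exact ⟨c / u, by positivity, by field_simp⟩
  have h := lintegral_image_eq_lintegral_abs_deriv_mul (s := Set.Ioi (0 : ℝ))
    (f := fun t => c / t) (f' := fun t => -c / t ^ 2) measurableSet_Ioi
    (fun t (ht : 0 < t) => by
      have := ((hasDerivAt_const t c).div (hasDerivAt_id t) ht.ne')
      exact (this.congr_deriv (by simp)).hasDerivWithinAt)
    (fun s (hs : 0 < s) t (ht : 0 < t) hst => by
      simp only at hst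
      field_simp at hst
      exact hst.symm) f
  rw [himg] at h
  rw [h]
  refine setLIntegral_congr_fun measurableSet_Ioi fun t _ => ?_
  simp only [neg_div, abs_neg]
  rw [abs_of_nonneg (by positivity)]

lemma lintegral_Ioi_comp_mul {c : ℝ} (hc : 0 < c) (f : ℝ → ℝ≥0∞) :
    ∫⁻ u in Set.Ioi (0 : ℝ), f u =
      ∫⁻ t in Set.Ioi (0 : ℝ), ENNReal.ofReal c * f (c * t) := by
  -- The scaling by `c` is the composition of the inversions u ↦ c / u and u ↦ 1 / u.
  rw [lintegral_Ioi_inversion hc, lintegral_Ioi_inversion one_pos]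
  refine setLIntegral_congr_fun measurableSet_Ioi fun t (ht : 0 < t) => ?_
  rw [← mul_assoc, ← ENNReal.ofReal_mul (by positivity)]
  congr 2 <;> field_simp

lemma lintegral_fin_prod {n : ℕ} (μ : Fin n → Measure ℝ) [∀ i, SigmaFinite (μ i)]
    {f : Fin n → ℝ → ℝ≥0∞} (hf : ∀ i, Measurable (f i)) :
    ∫⁻ x, ∏ i, f i (x i) ∂(Measure.pi μ) = ∏ i, ∫⁻ t, f i t ∂(μ i) := by
  induction n with
  | zero => simp
  | succ n ih =>
    rw [← ((measurePreserving_piFinSuccAbove μ 0).symm).lintegral_comp_emb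
      (MeasurableEquiv.measurableEmbedding _), Fin.prod_univ_succ, ← ih _ fun i => hf i.succ,
      ← lintegral_prod_mul (hf 0).aemeasurable
        (Finset.measurable_prod _ fun i _ => (hf i.succ).comp (measurable_pi_apply i)).aemeasurable]
    refine lintegral_congr fun z => ?_
    rw [Fin.prod_univ_succ]
    rfl

lemma pi_withDensity {n : ℕ} (μ : Fin n → Measure ℝ) [∀ i, SigmaFinite (μ i)]
    {f : Fin n → ℝ → ℝ≥0∞} (hf : ∀ i, Measurable (f i))
    [∀ i, SigmaFinite ((μ i).withDensity (f i))] :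
    Measure.pi (fun i => (μ i).withDensity (f i)) =
      (Measure.pi μ).withDensity (fun x => ∏ i, f i (x i)) := by
  refine (Measure.pi_eq fun s hs => ?_)
  rw [withDensity_apply _ (MeasurableSet.univ_pi hs), ← lintegral_indicator (MeasurableSet.univ_pi hs)]
  have h : ∀ x : Fin n → ℝ, (Set.univ.pi s).indicator (fun x => ∏ i, f i (x i)) x
      = ∏ i, (s i).indicator (f i) (x i) := by
    intro x
    by_cases hx : x ∈ Set.univ.pi s
    · rw [Set.indicator_of_mem hx]
      exact Finset.prod_congr rfl fun i _ => (Set.indicator_of_mem (hx i trivial) _).symm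
    · rw [Set.indicator_of_notMem hx]
      obtain ⟨i, hi⟩ : ∃ i, x i ∉ s i := by simpa using hx
      exact (Finset.prod_eq_zero (Finset.mem_univ i) (Set.indicator_of_notMem hi _)).symm
  simp_rw [h]
  rw [lintegral_fin_prod μ fun i => (hf i).indicator (hs i)]
  refine Finset.prod_congr rfl fun i _ => ?_
  rw [lintegral_indicator (hs i), withDensity_apply _ (hs i)]

/-- The standard Gaussian measure on `ℝⁿ`. -/
noncomputable def stdGauss (n : ℕ) : Measure (Fin n → ℝ) :=
  Measure.pi fun _ => gaussianReal 0 1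

instance (n : ℕ) : IsProbabilityMeasure (stdGauss n) := by
  unfold stdGauss
  infer_instance

lemma stdGauss_eq_withDensity (n : ℕ) :
    stdGauss n = (volume : Measure (Fin n → ℝ)).withDensity
      (fun x => ENNReal.ofReal ((√(2 * Real.pi))⁻¹ ^ n * Real.exp (-(∑ i, x i ^ 2) / 2))) := by
  have hσ : SigmaFinite ((volume : Measure ℝ).withDensity (gaussianPDF 0 1)) := by
    rw [← gaussianReal_of_var_ne_zero 0 one_ne_zero]
    infer_instance
  rw [stdGauss]
  simp_rw [gaussianReal_of_var_ne_zero 0 one_ne_zero]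
  rw [pi_withDensity (fun _ => volume) fun _ => measurable_gaussianPDF 0 1]
  congr 1
  ext x
  simp_rw [gaussianPDF, ← ENNReal.ofReal_prod_of_nonneg fun i _ => gaussianPDFReal_nonneg 0 1 (x i),
    gaussianPDFReal]
  rw [Finset.prod_mul_distrib, ← Real.exp_sum]
  simp [← Finset.sum_div]

lemma pi_gaussianReal_eq_withDensity (n : ℕ) (θ : ℝ) :
    Measure.pi (fun _ : Fin n => gaussianReal θ 1) = (stdGauss n).withDensity
      (fun x => ENNReal.ofReal (Real.exp (θ * ∑ i, x i - n * θ ^ 2 / 2))) := by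
  have h1 : gaussianReal θ 1 = (gaussianReal 0 1).withDensity
      (fun x => ENNReal.ofReal (Real.exp (θ * x - θ ^ 2 / 2))) := by
    rw [gaussianReal_of_var_ne_zero 0 one_ne_zero, gaussianReal_of_var_ne_zero θ one_ne_zero,
      ← withDensity_mul _ (measurable_gaussianPDF 0 1) (by fun_prop)]
    congr 1
    ext x
    simp only [Pi.mul_apply, gaussianPDF]
    rw [← ENNReal.ofReal_mul (gaussianPDFReal_nonneg 0 1 x), gaussianPDFReal, gaussianPDFReal,
      mul_assoc (√(2 * Real.pi * (1 : ℝ≥0)))⁻¹, ← Real.exp_add]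
    congr 3
    simp
    ring
  have hσ : SigmaFinite ((gaussianReal 0 1).withDensity
      (fun x => ENNReal.ofReal (Real.exp (θ * x - θ ^ 2 / 2)))) := by
    rw [← h1]
    infer_instance
  simp_rw [h1]
  rw [pi_withDensity (fun _ => gaussianReal 0 1) fun _ => by fun_prop, stdGauss]
  congr 1
  ext x
  rw [← ENNReal.ofReal_prod_of_nonneg fun i _ => (Real.exp_pos _).le, ← Real.exp_sum]
  simp [Finset.mul_sum, mul_div_assoc]

lemma lintegral_comp_const_mul {n : ℕ} {c : ℝ} (hc : 0 < c) {f : (Fin n → ℝ) → ℝ≥0∞}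
    (hf : Measurable f) :
    ∫⁻ x : Fin n → ℝ, f (fun i => c * x i) = ENNReal.ofReal ((c ^ n)⁻¹) * ∫⁻ x, f x := by
  have h := Measure.map_addHaar_smul (volume : Measure (Fin n → ℝ)) hc.ne'
  rw [Module.finrank_fin_fun, abs_of_pos (by positivity)] at h
  rw [← smul_eq_mul, ← lintegral_smul_measure, ← h, lintegral_map hf (measurable_const_smul c)]
  rfl

lemma ae_sum_sq_pos {n : ℕ} (hn : 1 ≤ n) :
    ∀ᵐ x : Fin n → ℝ, 0 < ∑ i, x i ^ 2 := by
  have : Nonempty (Fin n) := ⟨⟨0, hn⟩⟩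
  have h0 : ∀ᵐ x : Fin n → ℝ, x ≠ 0 := by
    simp [ae_iff]
  filter_upwards [h0] with x hx
  obtain ⟨i, hi⟩ := Function.ne_iff.mp hx
  exact Finset.sum_pos' (fun i _ => sq_nonneg _) ⟨i, Finset.mem_univ i, by
    have : x i ≠ 0 := hi
    positivity⟩

lemma stdGauss_absolutelyContinuous (n : ℕ) : stdGauss n ≪ volume := by
  rw [stdGauss_eq_withDensity]
  exact withDensity_absolutelyContinuous _ _

/-! ### Radial averaging -/

/-- The average of `F` over the rays, for the law of the radius of a standard Gaussian vector. -/
noncomputable def radialAvg (n : ℕ) (F : (Fin n → ℝ) → ℝ≥0∞) (x : Fin n → ℝ) : ℝ≥0∞ :=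
  ∫⁻ y in Set.Ioi (0 : ℝ), ENNReal.ofReal
    (y ^ ((n : ℝ) / 2 - 1) * Real.exp (-y) / Real.Gamma ((n : ℝ) / 2)) *
      F (fun i => √(2 * y / ∑ j, x j ^ 2) * x i)

lemma lintegral_gamma_kernel {s : ℝ} (hs : 0 < s) :
    ∫⁻ y in Set.Ioi (0 : ℝ), ENNReal.ofReal (y ^ (s - 1) * Real.exp (-y)) =
      ENNReal.ofReal (Real.Gamma s) := by
  rw [Real.Gamma_eq_integral hs, ofReal_integral_eq_lintegral_ofReal
    (Real.GammaIntegral_convergent hs)]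
  · simp_rw [mul_comm]
  · filter_upwards [ae_restrict_mem measurableSet_Ioi] with y (hy : 0 < y)
    exact mul_nonneg (Real.exp_pos _).le (Real.rpow_nonneg hy.le _)

lemma radialAvg_eq_lintegral {n : ℕ} (F : (Fin n → ℝ) → ℝ≥0∞) {x : Fin n → ℝ}
    (hx : 0 < ∑ j, x j ^ 2) :
    radialAvg n F x = ∫⁻ t in Set.Ioi (0 : ℝ), ENNReal.ofReal
      ((∑ j, x j ^ 2) * (((∑ j, x j ^ 2) * t) ^ ((n : ℝ) / 2 - 1) *
        Real.exp (-((∑ j, x j ^ 2) * t)) / Real.Gamma ((n : ℝ) / 2))) *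
        F (fun i => √(2 * t) * x i) := by
  rw [radialAvg, lintegral_Ioi_comp_mul hx]
  refine lintegral_congr fun t => ?_
  rw [← mul_assoc, ← ENNReal.ofReal_mul hx.le]
  congr 3
  ext i
  congr 2
  field_simp

/-- The total weight that a point with squared norm `v` receives from all points of its ray is its
own Gaussian density, so the averaging loses no mass. -/
lemma lintegral_radial_kernel {n : ℕ} (hn : 1 ≤ n) {v K : ℝ} (hv : 0 < v) (hK : 0 ≤ K) :
    ∫⁻ t in Set.Ioi (0 : ℝ), ENNReal.ofReal ((√(2 * t) ^ n)⁻¹ *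
      (K * Real.exp (-(v / (2 * t)) / 2) * (v / (2 * t) * ((v / 2) ^ ((n : ℝ) / 2 - 1) *
        Real.exp (-(v / 2)) / Real.Gamma ((n : ℝ) / 2))))) =
      ENNReal.ofReal (K * Real.exp (-v / 2)) := by
  have hn' : (0 : ℝ) < (n : ℝ) / 2 := by positivity
  have hG := Real.Gamma_pos_of_pos hn'
  have h := lintegral_gamma_kernel hn'
  -- The exponent -(v / (2t)) / 2 equals -y for y = v / (4t), which makes the `t`-integral a Gamma
  -- integral.
  rw [lintegral_Ioi_inversion (c := v / 4) (by positivity)] at h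
  have key : ∀ t ∈ Set.Ioi (0 : ℝ), ENNReal.ofReal ((√(2 * t) ^ n)⁻¹ *
      (K * Real.exp (-(v / (2 * t)) / 2) * (v / (2 * t) * ((v / 2) ^ ((n : ℝ) / 2 - 1) *
        Real.exp (-(v / 2)) / Real.Gamma ((n : ℝ) / 2))))) =
      ENNReal.ofReal (K * Real.exp (-v / 2) / Real.Gamma ((n : ℝ) / 2)) *
        (ENNReal.ofReal (v / 4 / t ^ 2) * ENNReal.ofReal ((v / 4 / t) ^ ((n : ℝ) / 2 - 1) *
          Real.exp (-(v / 4 / t)))) := by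
    intro t (ht : 0 < t)
    rw [← ENNReal.ofReal_mul (by positivity), ← ENNReal.ofReal_mul (by positivity)]
    congr 1
    have h1 : √(2 * t) ^ n = (2 * t) ^ ((n : ℝ) / 2 - 1) * (2 * t) := by
      rw [Real.sqrt_eq_rpow, ← Real.rpow_natCast, ← Real.rpow_mul (by positivity),
        ← Real.rpow_add_one (by positivity)]
      congr 1
      ring
    have h2 : v / 4 / t = v / 2 / (2 * t) := by
      field_simp
      norm_num
    have h3 : -(v / (2 * t)) / 2 = -(v / 4 / t) := by
      field_simp
      norm_num
    rw [h1, h3, neg_div]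
    conv_rhs => rw [h2, Real.div_rpow (by positivity) (by positivity)]
    rw [← h2]
    field_simp
    ring
  rw [setLIntegral_congr_fun measurableSet_Ioi key, lintegral_const_mul _ (by fun_prop), h,
    ← ENNReal.ofReal_mul (by positivity)]
  congr 1
  field_simp

/-- Against scale invariant functions, a function may be replaced by its radial average. -/
theorem lintegral_mul_radialAvg {n : ℕ} (hn : 1 ≤ n) {g F : (Fin n → ℝ) → ℝ≥0∞}
    (hg : Measurable g) (hinv : ∀ c : ℝ, 0 < c → ∀ x : Fin n → ℝ, g (fun i => c * x i) = g x)
    (hF : Measurable F) :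
    ∫⁻ x, g x * radialAvg n F x ∂(stdGauss n) = ∫⁻ x, g x * F x ∂(stdGauss n) := by
  set K : ℝ := (√(2 * Real.pi))⁻¹ ^ n
  have hK0 : 0 ≤ K := by positivity
  let V : (Fin n → ℝ) → ℝ := fun x => ∑ j, x j ^ 2
  have hV : Measurable V := by fun_prop
  have hVc : ∀ (c : ℝ) x, V (fun i => c * x i) = c ^ 2 * V x := fun c x => by
    simp only [V, mul_pow, Finset.mul_sum]
  let w : (Fin n → ℝ) → ℝ≥0∞ := fun x => ENNReal.ofReal (K * Real.exp (-V x / 2))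
  have hw : Measurable w := by fun_prop
  have hγ : stdGauss n = volume.withDensity w := stdGauss_eq_withDensity n
  have hradm : Measurable (radialAvg n F) := by
    unfold radialAvg
    fun_prop
  rw [hγ, lintegral_withDensity_eq_lintegral_mul _ hw (by fun_prop),
    lintegral_withDensity_eq_lintegral_mul _ hw (by fun_prop)]
  -- The integrand after y = V(x) t, written in the variable z = √(2t) x at which `F` is evaluated:
  -- V(x) = V(z) / (2t), V(x) t = V(z) / 2, and g(x) = g(z) by invariance.
  let Ψ : ℝ → (Fin n → ℝ) → ℝ≥0∞ := fun t z => g z * F z *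
    ENNReal.ofReal (K * Real.exp (-(V z / (2 * t)) / 2) * (V z / (2 * t) *
      ((V z / 2) ^ ((n : ℝ) / 2 - 1) * Real.exp (-(V z / 2)) / Real.Gamma ((n : ℝ) / 2))))
  have hΨ : Measurable (Function.uncurry Ψ) := by
    simp only [Function.uncurry_def, Ψ]
    fun_prop
  calc ∫⁻ x, (w * fun x => g x * radialAvg n F x) x
      = ∫⁻ x : Fin n → ℝ, ∫⁻ t in Set.Ioi (0 : ℝ), Ψ t (fun i => √(2 * t) * x i) := by
        refine lintegral_congr_ae ?_
        filter_upwards [ae_sum_sq_pos hn] with x (hx : 0 < V x)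
        simp only [Pi.mul_apply]
        rw [radialAvg_eq_lintegral F hx, ← mul_assoc, ← lintegral_const_mul _ (by fun_prop)]
        refine setLIntegral_congr_fun measurableSet_Ioi fun t (ht : 0 < t) => ?_
        have h2 : √(2 * t) ^ 2 = 2 * t := Real.sq_sqrt (by positivity)
        have h3 : 0 < √(2 * t) := by positivity
        simp only [Ψ, w, hinv _ h3, hVc, h2]
        rw [show 2 * t * V x / (2 * t) = V x by field_simp,
          show 2 * t * V x / 2 = V x * t by ring,
          ENNReal.ofReal_mul (p := K * Real.exp (-V x / 2)) (by positivity)]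
        change ENNReal.ofReal (K * Real.exp (-V x / 2)) * g x *
          (ENNReal.ofReal (V x * ((V x * t) ^ ((n : ℝ) / 2 - 1) * Real.exp (-(V x * t)) /
            Real.Gamma ((n : ℝ) / 2))) * _) = _
        ring
    _ = ∫⁻ t in Set.Ioi (0 : ℝ), ∫⁻ x : Fin n → ℝ, Ψ t (fun i => √(2 * t) * x i) := by
        rw [lintegral_lintegral_swap]
        refine Measurable.aemeasurable ?_
        exact hΨ.comp (g := Function.uncurry Ψ)
          (f := fun p : (Fin n → ℝ) × ℝ => (p.2, fun i => √(2 * p.2) * p.1 i)) (by fun_prop)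
    _ = ∫⁻ t in Set.Ioi (0 : ℝ), ∫⁻ z, ENNReal.ofReal ((√(2 * t) ^ n)⁻¹) * Ψ t z := by
        refine setLIntegral_congr_fun measurableSet_Ioi fun t (ht : 0 < t) => ?_
        have hm : Measurable (Ψ t) := hΨ.of_uncurry_left
        rw [lintegral_comp_const_mul (by positivity) hm, lintegral_const_mul _ hm]
    _ = ∫⁻ z, ∫⁻ t in Set.Ioi (0 : ℝ), ENNReal.ofReal ((√(2 * t) ^ n)⁻¹) * Ψ t z := by
        rw [lintegral_lintegral_swap]
        refine Measurable.aemeasurable ?_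
        exact Measurable.mul (by fun_prop) hΨ
    _ = ∫⁻ z, (w * fun z => g z * F z) z := by
        refine lintegral_congr_ae ?_
        filter_upwards [ae_sum_sq_pos hn] with z (hz : 0 < V z)
        simp only [Pi.mul_apply, w, Ψ]
        rw [← lintegral_radial_kernel hn hz hK0, mul_comm _ (g z * F z),
          ← lintegral_const_mul _ (by fun_prop)]
        refine setLIntegral_congr_fun measurableSet_Ioi fun t (ht : 0 < t) => ?_
        rw [ENNReal.ofReal_mul (p := (√(2 * t) ^ n)⁻¹) (by positivity)]
        ring

/-! ### `h_θ` and `H` as functions on ℝⁿ -/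

lemma pSum_eq_sum_fin (n : ℕ) (x : ℕ → ℝ) : pSum n x = ∑ i : Fin n, x i :=
  (Fin.sum_univ_eq_sum_range x n).symm

lemma pSumSq_eq_sum_fin (n : ℕ) (x : ℕ → ℝ) : pSumSq n x = ∑ i : Fin n, x i ^ 2 :=
  (Fin.sum_univ_eq_sum_range (fun i => x i ^ 2) n).symm

/-- The likelihood ratio of `N(θ, 1)ⁿ` against `N(0, 1)ⁿ`. -/
noncomputable def shiftLR (θ : ℝ) (n : ℕ) (x : Fin n → ℝ) : ℝ≥0∞ :=
  ENNReal.ofReal (Real.exp (θ * ∑ i, x i - n * θ ^ 2 / 2))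

/-- The point √(2y/V) x on the ray of `x` has sum S √(2y/V), which is the linear term in the
exponent of `h_θ`. -/
lemma tLR_eq_radialAvg (θ : ℝ) {n : ℕ} (hn : 1 ≤ n) (x : ℕ → ℝ) :
    tLR θ n x = radialAvg n (shiftLR θ n) (fun i => x i) := by
  have hG := Real.Gamma_pos_of_pos (show (0 : ℝ) < (n : ℝ) / 2 by positivity)
  rw [tLR, radialAvg, ← lintegral_const_mul _ (by fun_prop), pSum_eq_sum_fin, pSumSq_eq_sum_fin]
  refine setLIntegral_congr_fun measurableSet_Ioi fun y (hy : 0 < y) => ?_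
  have := Real.rpow_nonneg hy.le ((n : ℝ) / 2 - 1)
  rw [shiftLR, ← ENNReal.ofReal_mul (by positivity), ← ENNReal.ofReal_mul (by positivity),
    ← Finset.mul_sum, Real.exp_add, sub_eq_add_neg (θ * _), Real.exp_add]
  congr 1
  ring_nf

/-- The value of `tENSM` as a function on `ℝⁿ`. -/
noncomputable def tENSMFin (n : ℕ) (x : Fin n → ℝ) : ℝ≥0∞ :=
  if n ≤ 1 then ∞ else
    ENNReal.ofReal (√(2 * Real.pi / n)) *
      (ENNReal.ofReal (n * ∑ i, x i ^ 2) / ENNReal.ofReal (n * ∑ i, x i ^ 2 - (∑ i, x i) ^ 2))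
        ^ ((n : ℝ) / 2)

lemma tENSM_eq_tENSMFin (n : ℕ) (x : ℕ → ℝ) : tENSM n x = tENSMFin n (fun i => x i) := by
  rw [tENSM, tENSMFin, pSum_eq_sum_fin, pSumSq_eq_sum_fin]

lemma measurable_tENSMFin (n : ℕ) : Measurable (tENSMFin n) := by
  unfold tENSMFin
  split_ifs
  · exact measurable_const
  · fun_prop

lemma tENSMFin_const_mul {n : ℕ} {c : ℝ} (hc : 0 < c) (x : Fin n → ℝ) :
    tENSMFin n (fun i => c * x i) = tENSMFin n x := by
  unfold tENSMFin
  split_ifs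
  · rfl
  · have h1 : (n : ℝ) * ∑ i, (c * x i) ^ 2 = c ^ 2 * (n * ∑ i, x i ^ 2) := by
      simp_rw [mul_pow, ← Finset.mul_sum]
      ring
    have h2 : c ^ 2 * (n * ∑ i, x i ^ 2) - (∑ i, c * x i) ^ 2 =
        c ^ 2 * (n * ∑ i, x i ^ 2 - (∑ i, x i) ^ 2) := by
      rw [← Finset.mul_sum]
      ring
    rw [h1, h2, ENNReal.ofReal_mul (p := c ^ 2) (by positivity),
      ENNReal.ofReal_mul (p := c ^ 2) (by positivity),
      ENNReal.mul_div_mul_left _ _ (ENNReal.ofReal_pos.mpr (by positivity)).ne'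
        ENNReal.ofReal_ne_top]

lemma measurable_radialAvg_shiftLR (n : ℕ) :
    Measurable (fun p : ℝ × (Fin n → ℝ) => radialAvg n (shiftLR p.1 n) p.2) := by
  unfold radialAvg shiftLR
  fun_prop

lemma measurable_shiftLR (θ : ℝ) (n : ℕ) : Measurable (shiftLR θ n) := by
  unfold shiftLR
  fun_prop

lemma radialAvg_const_mul {n : ℕ} (F : (Fin n → ℝ) → ℝ≥0∞) {c : ℝ} (hc : 0 < c) (x : Fin n → ℝ) :
    radialAvg n F (fun i => c * x i) = radialAvg n F x := by
  unfold radialAvg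
  refine lintegral_congr fun y => ?_
  congr 2
  ext i
  simp_rw [mul_pow, ← Finset.mul_sum]
  rw [← mul_assoc, ← div_div, div_right_comm, Real.sqrt_div' _ (by positivity), Real.sqrt_sq hc.le]
  field_simp

/-! ### The martingales `h_θ` -/

section Law

variable {Ω : Type*} [mΩ : MeasurableSpace Ω] {P : Measure Ω} {X : ℕ → Ω → ℝ} {v : ℝ≥0}

lemma IsIIDGaussian.map_eq_pi {μ : ℝ} (h : IsIIDGaussian P X μ v) (hX : ∀ i, Measurable (X i))
    (n : ℕ) : P.map (fun ω (i : Fin n) => X i ω) = Measure.pi fun _ => gaussianReal μ v := by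
  have hind : iIndepFun (fun i : Fin n => X i) P := h.indep.precomp Fin.val_injective
  rw [iIndepFun.map_fun_eq_pi_map (f := fun i : Fin n => X i) (fun i => (hX i).aemeasurable) hind]
  simp_rw [(h.law _).map_eq]

lemma pi_gaussianReal_eq_map (n : ℕ) (v : ℝ≥0) :
    Measure.pi (fun _ : Fin n => gaussianReal 0 v) =
      (stdGauss n).map (fun x i => √v * x i) := by
  have h : gaussianReal 0 v = (gaussianReal 0 1).map (fun t => √v * t) := by
    rw [gaussianReal_map_const_mul]
    congr 1
    · simp
    · ext
      simp
  have : SigmaFinite ((gaussianReal 0 1).map (fun t => √v * t)) := by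
    rw [← h]
    infer_instance
  rw [stdGauss, Measure.pi_map_pi (f := fun _ t => √v * t) fun _ => by fun_prop]
  simp_rw [← h]

/-- The data are √v times a standard Gaussian vector in law, and `g` does not see the factor. -/
lemma IsIIDGaussian.lintegral_eq (h : IsIIDGaussian P X 0 v) (hv : v ≠ 0)
    (hX : ∀ i, Measurable (X i)) {n : ℕ} {g : (Fin n → ℝ) → ℝ≥0∞} (hg : Measurable g)
    (hinv : ∀ c : ℝ, 0 < c → ∀ x : Fin n → ℝ, g (fun i => c * x i) = g x) :
    ∫⁻ ω, g (fun i => X i ω) ∂P = ∫⁻ x, g x ∂(stdGauss n) := by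
  rw [← lintegral_map hg (measurable_pi_lambda _ fun i => hX i), h.map_eq_pi hX,
    pi_gaussianReal_eq_map, lintegral_map hg (by fun_prop)]
  have hv' : 0 < √(v : ℝ) := by positivity
  simp_rw [hinv _ hv']

/-- This identifies `h_θ` as the likelihood ratio of `N(θ, 1)` against `N(0, v)` on the scale
invariant σ-algebra. -/
lemma IsIIDGaussian.setLIntegral_tLR (h : IsIIDGaussian P X 0 v) (hv : v ≠ 0)
    (hX : ∀ i, Measurable (X i)) (θ : ℝ) {n : ℕ} (hn : 1 ≤ n) {A : Set (Fin n → ℝ)}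
    (hA : MeasurableSet A) (hAc : ∀ c : ℝ, 0 < c → ∀ x : Fin n → ℝ, (fun i => c * x i) ∈ A ↔ x ∈ A) :
    ∫⁻ ω in (fun ω (i : Fin n) => X i ω) ⁻¹' A, tLR θ n (fun i => X i ω) ∂P =
      Measure.pi (fun _ => gaussianReal θ 1) A := by
  have hXm : Measurable (fun ω (i : Fin n) => X i ω) := measurable_pi_lambda _ fun i => hX i
  have hm : Measurable (radialAvg n (shiftLR θ n)) :=
    (measurable_radialAvg_shiftLR n).comp measurable_prodMk_left
  have h1 : Measurable (A.indicator (fun _ => (1 : ℝ≥0∞))) := measurable_const.indicator hA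
  have h2 : ∀ c : ℝ, 0 < c → ∀ x : Fin n → ℝ,
      A.indicator (fun _ => (1 : ℝ≥0∞)) (fun i => c * x i) = A.indicator (fun _ => 1) x := by
    intro c hc x
    classical
    simp only [Set.indicator_apply, hAc c hc x]
  rw [← lintegral_indicator (hXm hA)]
  simp_rw [tLR_eq_radialAvg θ hn]
  calc _ = ∫⁻ ω, (fun x => A.indicator (fun _ => (1 : ℝ≥0∞)) x * radialAvg n (shiftLR θ n) x)
        (fun i => X i ω) ∂P := by
        refine lintegral_congr fun ω => ?_
        by_cases hω : (fun i : Fin n => X i ω) ∈ A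
        · rw [Set.indicator_of_mem (by exact hω)]
          simp [hω]
        · rw [Set.indicator_of_notMem (by exact hω)]
          simp [hω]
    _ = ∫⁻ x, A.indicator (fun _ => (1 : ℝ≥0∞)) x * radialAvg n (shiftLR θ n) x ∂(stdGauss n) :=
        h.lintegral_eq hv hX (h1.mul hm) fun c hc x => by
          rw [Pi.mul_apply, Pi.mul_apply, h2 c hc, radialAvg_const_mul _ hc]
    _ = ∫⁻ x, A.indicator (fun _ => (1 : ℝ≥0∞)) x * shiftLR θ n x ∂(stdGauss n) :=
        lintegral_mul_radialAvg hn h1 h2 (measurable_shiftLR θ n)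
    _ = _ := by
        rw [pi_gaussianReal_eq_withDensity, withDensity_apply _ hA, ← lintegral_indicator hA]
        refine lintegral_congr fun x => ?_
        by_cases hx : x ∈ A <;> simp [hx, shiftLR]

lemma pi_map_castSucc (ν : Measure ℝ) [IsProbabilityMeasure ν] (n : ℕ) :
    (Measure.pi fun _ : Fin (n + 1) => ν).map (fun x (i : Fin n) => x i.castSucc) =
      Measure.pi fun _ => ν := by
  have h := (iIndepFun_pi (μ := fun _ : Fin (n + 1) => ν) (X := fun _ t => t)
    fun _ => aemeasurable_id).precomp (Fin.castSucc_injective n)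
  rw [h.map_fun_eq_pi_map fun i => (measurable_pi_apply _).aemeasurable]
  congr 1
  ext1 i
  exact (measurePreserving_eval (fun _ : Fin (n + 1) => ν) i.castSucc).map_eq

/-- Both sides are the `N(θ, 1)` probability of one event: a cone in the first `n` coordinates is
also a cone in n + 1 coordinates. -/
lemma IsIIDGaussian.setLIntegral_tLR_succ (h : IsIIDGaussian P X 0 v) (hv : v ≠ 0)
    (hX : ∀ i, Measurable (X i)) (θ : ℝ) {n : ℕ} (hn : 1 ≤ n) {s : Set Ω}
    (hs : MeasurableSet[scaleInvFiltration X hX n] s) :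
    ∫⁻ ω in s, tLR θ n (fun i => X i ω) ∂P = ∫⁻ ω in s, tLR θ (n + 1) (fun i => X i ω) ∂P := by
  obtain ⟨A, hA, hAc, rfl⟩ := exists_cone_of_measurableSet hs
  have hm : Measurable (fun (x : Fin (n + 1) → ℝ) (i : Fin n) => x i.castSucc) := by fun_prop
  rw [h.setLIntegral_tLR hv hX θ hn hA hAc, ← pi_map_castSucc, Measure.map_apply hm hA,
    ← h.setLIntegral_tLR hv hX θ (Nat.le_add_left 1 n) (hm hA) fun c hc x => hAc c hc _]
  rfl

lemma measurable_tLR_scaleInv (hX : ∀ i, Measurable (X i)) (θ : ℝ) {n : ℕ} (hn : 1 ≤ n) :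
    Measurable[scaleInvFiltration X hX n] (fun ω => tLR θ n (fun i => X i ω)) := by
  simp_rw [tLR_eq_radialAvg θ hn]
  exact measurable_scaleInvSigma X
    ((measurable_radialAvg_shiftLR n).comp measurable_prodMk_left)
    fun c hc x => radialAvg_const_mul _ hc x

theorem IsIIDGaussian.isNM_tLR [IsProbabilityMeasure P] (h : IsIIDGaussian P X 0 v) (hv : v ≠ 0)
    (hX : ∀ i, Measurable (X i)) (θ : ℝ) :
    IsNM P (scaleInvFiltration X hX) 1 (fun n ω => tLR θ n (fun i => X i ω)) where
  integrable := by
    have := h.setLIntegral_tLR hv hX θ le_rfl MeasurableSet.univ (by simp)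
    rw [Set.preimage_univ, setLIntegral_univ] at this
    simp [this]
  adapted n hn := measurable_tLR_scaleInv hX θ hn
  condExp_eq n hn :=
    (ae_eq_condLExp ((scaleInvFiltration X hX).le n) P _ (measurable_tLR_scaleInv hX θ hn)
      fun _ hs => h.setLIntegral_tLR_succ hv hX θ hn hs).symm

end Law

/-! ### The flat mixture over `θ` -/

lemma lintegral_exp_linear_sub_sq {n : ℝ} (hn : 0 < n) (b : ℝ) :
    ∫⁻ θ : ℝ, ENNReal.ofReal (Real.exp (θ * b - n * θ ^ 2 / 2)) =
      ENNReal.ofReal (√(2 * Real.pi / n) * Real.exp (b ^ 2 / (2 * n))) := by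
  -- Completing the square makes the integrand a multiple of the `N(b/n, 1/n)` density.
  let w : ℝ≥0 := ⟨1 / n, by positivity⟩
  have hw : w ≠ 0 := by
    rw [← NNReal.coe_ne_zero]
    exact (one_div_pos.mpr hn).ne'
  have hwn : (w : ℝ) = 1 / n := rfl
  have h := lintegral_gaussianPDFReal_eq_one (b / n) hw
  have key : ∀ θ : ℝ, ENNReal.ofReal (Real.exp (θ * b - n * θ ^ 2 / 2)) =
      ENNReal.ofReal (√(2 * Real.pi / n) * Real.exp (b ^ 2 / (2 * n))) *
        ENNReal.ofReal (gaussianPDFReal (b / n) w θ) := by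
    intro θ
    rw [← ENNReal.ofReal_mul (by positivity), gaussianPDFReal, hwn, mul_one_div]
    congr 1
    have hs : √(2 * Real.pi / n) ≠ 0 := by positivity
    rw [mul_mul_mul_comm, mul_inv_cancel₀ hs, one_mul, ← Real.exp_add]
    congr 1
    field_simp
    ring
  simp_rw [key]
  rw [lintegral_const_mul _ (by fun_prop), h, mul_one]

lemma lintegral_rpow_mul_exp_Ioi {s r : ℝ} (hs : 0 < s) (hr : 0 < r) :
    ∫⁻ y in Set.Ioi (0 : ℝ), ENNReal.ofReal (y ^ (s - 1) * Real.exp (-(r * y)) / Real.Gamma s) =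
      ENNReal.ofReal (r ^ (-s)) := by
  have hG := Real.Gamma_pos_of_pos hs
  have h := lintegral_gamma_kernel hs
  rw [lintegral_Ioi_comp_mul hr] at h
  have key : ∀ y ∈ Set.Ioi (0 : ℝ),
      ENNReal.ofReal (y ^ (s - 1) * Real.exp (-(r * y)) / Real.Gamma s) =
      ENNReal.ofReal (r ^ (-s) / Real.Gamma s) *
        (ENNReal.ofReal r * ENNReal.ofReal ((r * y) ^ (s - 1) * Real.exp (-(r * y)))) := by
    intro y (hy : 0 < y)
    rw [← ENNReal.ofReal_mul hr.le, ← ENNReal.ofReal_mul (by positivity)]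
    congr 1
    rw [Real.mul_rpow hr.le hy.le, Real.rpow_neg hr.le, Real.rpow_sub_one hr.ne' s]
    have : r ^ s ≠ 0 := by positivity
    field_simp
  rw [setLIntegral_congr_fun measurableSet_Ioi key, lintegral_const_mul _ (by fun_prop), h,
    ← ENNReal.ofReal_mul (by positivity), div_mul_cancel₀ _ hG.ne']

lemma lintegral_rpow_Ioi_eq_top {s : ℝ} (hs : 0 < s) :
    ∫⁻ y in Set.Ioi (0 : ℝ), ENNReal.ofReal (y ^ (s - 1) / Real.Gamma s) = ∞ := by
  have hG := Real.Gamma_pos_of_pos hs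
  refine ENNReal.eq_top_of_forall_nnreal_le fun K => ?_
  have hK : (0 : ℝ) < K + 1 := by positivity
  -- Inserting exp(-r y) ≤ 1 only decreases the integral, to r ^ (-s); this `r` makes that value K +
  -- 1.
  have h := lintegral_rpow_mul_exp_Ioi hs (r := (K + 1 : ℝ) ^ (-(1 / s))) (by positivity)
  rw [← Real.rpow_mul hK.le, show -(1 / s) * -s = 1 by field_simp, Real.rpow_one] at h
  calc (K : ℝ≥0∞) ≤ ENNReal.ofReal (K + 1) := by
        rw [← ENNReal.ofReal_coe_nnreal]
        exact ENNReal.ofReal_le_ofReal (by linarith)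
    _ ≤ _ := by
        rw [← h]
        refine setLIntegral_mono' measurableSet_Ioi fun y (hy : 0 < y) => ENNReal.ofReal_le_ofReal ?_
        gcongr
        refine mul_le_of_le_one_right (by positivity) (Real.exp_le_one_iff.mpr ?_)
        rw [neg_nonpos]
        positivity

/-- The process `H` is the flat mixture of the likelihood ratios. -/
theorem lintegral_radialAvg_shiftLR {n : ℕ} (hn : 1 ≤ n) {x : Fin n → ℝ}
    (hx : 0 < ∑ i, x i ^ 2) :
    ∫⁻ θ : ℝ, radialAvg n (shiftLR θ n) x = tENSMFin n x := by
  have hn0 : (0 : ℝ) < n := by positivity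
  have hG := Real.Gamma_pos_of_pos (show (0 : ℝ) < (n : ℝ) / 2 by positivity)
  set S := ∑ i, x i with hS
  set V := ∑ i, x i ^ 2 with hV
  have hCS : S ^ 2 ≤ n * V := by
    simpa using sq_sum_le_card_mul_sum_sq (s := Finset.univ) (f := x)
  -- The `θ`-integral leaves exp(-y + y S² / (n V)) = exp(-r y), and 1 / r is the quotient in `H`.
  -- The case r = 0 is equality in Cauchy–Schwarz, where both sides are infinite; it always occurs
  -- for n = 1, which accounts for H₁ = ∞.
  set r : ℝ := 1 - S ^ 2 / (n * V) with hr
  have hswap : ∫⁻ θ : ℝ, radialAvg n (shiftLR θ n) x =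
      ∫⁻ y in Set.Ioi (0 : ℝ), ENNReal.ofReal (√(2 * Real.pi / n)) *
        ENNReal.ofReal (y ^ ((n : ℝ) / 2 - 1) * Real.exp (-(r * y)) / Real.Gamma ((n : ℝ) / 2)) := by
    unfold radialAvg shiftLR
    rw [lintegral_lintegral_swap (by fun_prop)]
    refine setLIntegral_congr_fun measurableSet_Ioi fun y (hy : 0 < y) => ?_
    rw [lintegral_const_mul _ (by fun_prop), lintegral_exp_linear_sub_sq hn0, ← Finset.mul_sum,
      mul_pow, Real.sq_sqrt (by positivity), ← ENNReal.ofReal_mul (by positivity),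
      ← ENNReal.ofReal_mul (by positivity)]
    congr 1
    have : Real.exp (-(r * y)) = Real.exp (-y) * Real.exp (2 * y / V * S ^ 2 / (2 * n)) := by
      rw [← Real.exp_add, hr]
      congr 1
      field_simp
      ring
    rw [this]
    ring
  rw [hswap, lintegral_const_mul _ (by fun_prop)]
  have hsq : ENNReal.ofReal (√(2 * Real.pi / n)) ≠ 0 :=
    (ENNReal.ofReal_pos.mpr (by positivity)).ne'
  have hr0 : 0 ≤ r := by
    rw [hr, sub_nonneg]
    exact div_le_one_of_le₀ hCS (by positivity)
  have hrV : n * V - S ^ 2 = r * (n * V) := by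
    rw [hr]
    field_simp
  rw [tENSMFin, ← hS, ← hV, hrV]
  rcases hr0.eq_or_lt with h0 | h0
  · rw [← h0]
    simp only [zero_mul, neg_zero, Real.exp_zero, mul_one, ENNReal.ofReal_zero]
    rw [lintegral_rpow_Ioi_eq_top (by positivity), ENNReal.mul_top hsq]
    split_ifs
    · rfl
    · rw [ENNReal.div_zero (ENNReal.ofReal_pos.mpr (by positivity)).ne',
        ENNReal.top_rpow_of_pos (by positivity), ENNReal.mul_top hsq]
  · have hn1 : ¬ n ≤ 1 := by
      intro h
      obtain rfl : n = 1 := by omega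
      have : r = 0 := by
        have hSV : S ^ 2 = V := by simp [hS, hV]
        rw [hr, hSV, Nat.cast_one, one_mul, div_self hx.ne', sub_self]
      exact h0.ne' this
    rw [if_neg hn1, lintegral_rpow_mul_exp_Ioi (by positivity) h0]
    congr 1
    rw [← ENNReal.ofReal_div_of_pos (by positivity), ENNReal.ofReal_rpow_of_pos (by positivity)]
    congr 1
    rw [Real.rpow_neg h0.le, ← Real.inv_rpow h0.le]
    congr 1
    field_simp

/-! ### `H` as an extended supermartingale -/

section Law

variable {Ω : Type*} [mΩ : MeasurableSpace Ω] {P : Measure Ω} {X : ℕ → Ω → ℝ} {v : ℝ≥0}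

/-- The complement of an invariant set is invariant, so its probability can be computed at unit
variance. -/
lemma IsIIDGaussian.ae_of_ae_stdGauss (h : IsIIDGaussian P X 0 v) (hv : v ≠ 0)
    (hX : ∀ i, Measurable (X i)) {n : ℕ} {s : Set (Fin n → ℝ)} (hs : MeasurableSet s)
    (hinv : ∀ c : ℝ, 0 < c → ∀ x : Fin n → ℝ, (fun i => c * x i) ∈ s ↔ x ∈ s)
    (hae : ∀ᵐ x ∂(stdGauss n), x ∈ s) : ∀ᵐ ω ∂P, (fun i : Fin n => X i ω) ∈ s := by
  have hm : Measurable (sᶜ.indicator (fun _ => (1 : ℝ≥0∞))) := measurable_const.indicator hs.compl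
  have h1 := h.lintegral_eq hv hX hm fun c hc x => by
    classical
    simp only [Set.indicator_apply, Set.mem_compl_iff, hinv c hc x]
  have h2 : ∫⁻ x, sᶜ.indicator (fun _ => (1 : ℝ≥0∞)) x ∂(stdGauss n) = 0 := by
    rw [lintegral_indicator hs.compl]
    simpa using mem_ae_iff.mp hae
  rw [h2, lintegral_eq_zero_iff (f := fun ω => sᶜ.indicator (fun _ => (1 : ℝ≥0∞)) fun i => X i ω)
    (hm.comp (measurable_pi_lambda _ fun i => hX i))] at h1
  filter_upwards [h1] with ω hω
  by_contra hcon
  simp [hcon] at hω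

lemma IsIIDGaussian.tENSM_eq_lintegral_tLR (h : IsIIDGaussian P X 0 v) (hv : v ≠ 0)
    (hX : ∀ i, Measurable (X i)) {n : ℕ} (hn : 1 ≤ n) :
    ∀ᵐ ω ∂P, tENSM n (fun i => X i ω) = ∫⁻ θ : ℝ, tLR θ n (fun i => X i ω) := by
  have hae : ∀ᵐ ω ∂P, (fun i : Fin n => X i ω) ∈ {x : Fin n → ℝ | 0 < ∑ i, x i ^ 2} := by
    refine h.ae_of_ae_stdGauss hv hX (measurableSet_lt measurable_const (by fun_prop)) ?_
      ((stdGauss_absolutelyContinuous n) (ae_sum_sq_pos hn))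
    intro c hc x
    simp only [Set.mem_ofPred_eq, mul_pow, ← Finset.mul_sum]
    exact mul_pos_iff_of_pos_left (by positivity)
  filter_upwards [hae] with ω hω
  simp_rw [tLR_eq_radialAvg _ hn]
  rw [lintegral_radialAvg_shiftLR hn hω, tENSM_eq_tENSMFin]

lemma IsIIDGaussian.setLIntegral_tENSM [SFinite P] (h : IsIIDGaussian P X 0 v) (hv : v ≠ 0)
    (hX : ∀ i, Measurable (X i)) {n : ℕ} (hn : 1 ≤ n) (s : Set Ω) :
    ∫⁻ ω in s, tENSM n (fun i => X i ω) ∂P = ∫⁻ θ : ℝ, ∫⁻ ω in s, tLR θ n (fun i => X i ω) ∂P := by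
  rw [lintegral_congr_ae (ae_restrict_of_ae (h.tENSM_eq_lintegral_tLR hv hX hn)),
    lintegral_lintegral_swap]
  simp_rw [tLR_eq_radialAvg _ hn]
  exact ((measurable_radialAvg_shiftLR n).comp (g := fun p : ℝ × (Fin n → ℝ) => _)
    (f := fun p : Ω × ℝ => (p.2, fun i : Fin n => X i p.1)) (by fun_prop)).aemeasurable

lemma measurable_tENSM_scaleInv (hX : ∀ i, Measurable (X i)) (n : ℕ) :
    Measurable[scaleInvFiltration X hX n] (fun ω => tENSM n (fun i => X i ω)) := by
  simp_rw [tENSM_eq_tENSMFin]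
  exact measurable_scaleInvSigma X (measurable_tENSMFin n) fun c hc x => tENSMFin_const_mul hc x

theorem IsIIDGaussian.isENSM_tENSM [IsProbabilityMeasure P] (h : IsIIDGaussian P X 0 v)
    (hv : v ≠ 0) (hX : ∀ i, Measurable (X i)) :
    IsENSM P (scaleInvFiltration X hX) 1 (fun n ω => tENSM n (fun i => X i ω)) where
  adapted n _ := measurable_tENSM_scaleInv hX n
  condExp_le n hn := by
    -- Equality holds here, possibly between infinite values.
    refine (ae_eq_condLExp ((scaleInvFiltration X hX).le n) P _ (measurable_tENSM_scaleInv hX n)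
      fun s hs => ?_).symm.le
    rw [h.setLIntegral_tENSM hv hX hn, h.setLIntegral_tENSM hv hX (Nat.le_add_left 1 n)]
    simp_rw [h.setLIntegral_tLR_succ hv hX _ hn hs]

lemma IsIIDGaussian.sub_const {μ : ℝ} (h : IsIIDGaussian P X μ v) :
    IsIIDGaussian P (fun i ω => X i ω - μ) 0 v where
  indep := h.indep.comp (fun _ t => t - μ) fun _ => by fun_prop
  law i := by
    have h1 : HasLaw (fun t : ℝ => t - μ) (gaussianReal 0 v) (gaussianReal μ v) :=
      ⟨by fun_prop, by rw [gaussianReal_map_sub_const, sub_self]⟩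
    exact h1.comp (h.law i)

end Law

/-! ### Student's t-distribution of the t-statistic -/

/-- The mean of the chi distribution with `k` degrees of freedom. -/
lemma lintegral_norm_stdGauss {k : ℕ} (hk : 1 ≤ k) :
    ∫⁻ x, ENNReal.ofReal √(∑ i, x i ^ 2) ∂(stdGauss k) =
      ENNReal.ofReal (√2 * Real.Gamma (((k : ℝ) + 1) / 2) / Real.Gamma ((k : ℝ) / 2)) := by
  have hG := Real.Gamma_pos_of_pos (show (0 : ℝ) < (k : ℝ) / 2 by positivity)
  -- On each ray the norm becomes √(2y), so its radial average is constant, a ratio of Gamma values.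
  have h := lintegral_mul_radialAvg hk (g := fun _ => 1)
    (F := fun x => ENNReal.ofReal √(∑ i, x i ^ 2)) measurable_const (fun _ _ _ => rfl) (by fun_prop)
  simp only [one_mul] at h
  rw [← h]
  have key : ∀ᵐ x ∂(stdGauss k), radialAvg k (fun x => ENNReal.ofReal √(∑ i, x i ^ 2)) x =
      ENNReal.ofReal (√2 * Real.Gamma (((k : ℝ) + 1) / 2) / Real.Gamma ((k : ℝ) / 2)) := by
    filter_upwards [(stdGauss_absolutelyContinuous k) (ae_sum_sq_pos hk)]
      with x (hx : 0 < ∑ i, x i ^ 2)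
    have hG2 := lintegral_gamma_kernel (show (0 : ℝ) < ((k : ℝ) + 1) / 2 by positivity)
    rw [radialAvg, mul_div_right_comm, ENNReal.ofReal_mul (by positivity), ← hG2,
      ← lintegral_const_mul _ (by fun_prop)]
    refine setLIntegral_congr_fun measurableSet_Ioi fun y (hy : 0 < y) => ?_
    simp_rw [mul_pow, ← Finset.mul_sum]
    rw [Real.sq_sqrt (by positivity), div_mul_cancel₀ _ hx.ne', ← ENNReal.ofReal_mul (by positivity),
      ← ENNReal.ofReal_mul (by positivity), Real.sqrt_mul (by positivity)]
    congr 1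
    have : y ^ (((k : ℝ) + 1) / 2 - 1) = y ^ ((k : ℝ) / 2 - 1) * √y := by
      rw [Real.sqrt_eq_rpow, ← Real.rpow_add hy]
      congr 1
      ring
    rw [this]
    ring
  rw [lintegral_congr_ae key, lintegral_const, measure_univ, mul_one]

/-- Rotation invariance, for functions of the sum and the sum of squares. -/
lemma lintegral_sum_sumSq_stdGauss {k : ℕ} {Φ : ℝ × ℝ → ℝ≥0∞} (hΦ : Measurable Φ) :
    ∫⁻ x : Fin (k + 1) → ℝ, Φ (∑ i, x i, ∑ i, x i ^ 2) ∂(stdGauss (k + 1)) =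
      ∫⁻ x : Fin (k + 1) → ℝ, Φ (√((k : ℝ) + 1) * x 0, ∑ i, x i ^ 2) ∂(stdGauss (k + 1)) := by
  -- The unit diagonal vector, completed to an orthonormal basis: the sum of the coordinates is
  -- √(k+1) times the coordinate along `u`.
  let u : EuclideanSpace ℝ (Fin (k + 1)) := WithLp.toLp 2 fun _ => (√((k : ℝ) + 1))⁻¹
  have hs : √((k : ℝ) + 1) ≠ 0 := by positivity
  have hu : ‖u‖ = 1 := by
    rw [← sq_eq_sq₀ (norm_nonneg _) zero_le_one, EuclideanSpace.real_norm_sq_eq]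
    have : ((k : ℝ) + 1) ≠ 0 := by positivity
    simp [u, Real.sq_sqrt (show (0 : ℝ) ≤ (k : ℝ) + 1 by positivity), this]
  have hon : Orthonormal ℝ (({0} : Set (Fin (k + 1))).domRestrict fun _ => u) := by
    refine ⟨fun i => hu, fun i j hij => ?_⟩
    exact absurd (Subsingleton.elim i j) hij
  obtain ⟨b, hb⟩ := hon.exists_orthonormalBasis_extension_of_card_eq (by simp)
  have hb0 : b 0 = u := hb 0 rfl
  have hsum : ∀ z : EuclideanSpace ℝ (Fin (k + 1)), ∑ i, z i = √((k : ℝ) + 1) * inner ℝ u z := by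
    intro z
    rw [PiLp.inner_apply]
    simp only [u, RCLike.inner_apply, conj_trivial, ← Finset.sum_mul]
    field_simp
  have hm : Measurable fun z : EuclideanSpace ℝ (Fin (k + 1)) => Φ (∑ i, z i, ‖z‖ ^ 2) :=
    hΦ.comp (by fun_prop)
  have h1 : ∫⁻ x : Fin (k + 1) → ℝ, Φ (∑ i, x i, ∑ i, x i ^ 2) ∂(stdGauss (k + 1)) =
      ∫⁻ z : EuclideanSpace ℝ (Fin (k + 1)), Φ (∑ i, z i, ‖z‖ ^ 2) ∂(stdGaussian _) := by
    rw [← map_pi_eq_stdGaussian, lintegral_map hm (by fun_prop)]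
    simp_rw [EuclideanSpace.real_norm_sq_eq]
    rfl
  rw [h1, stdGaussian_eq_map_pi_orthonormalBasis b, lintegral_map hm (by fun_prop)]
  refine lintegral_congr fun x => ?_
  congr 2
  · rw [hsum, ← hb0, inner_sum]
    simp [inner_smul_right, b.inner_eq_ite]
  · rw [← b.sum_sq_norm_inner_right]
    refine Finset.sum_congr rfl fun j _ => ?_
    rw [inner_sum]
    simp [inner_smul_right, b.inner_eq_ite]

lemma lintegral_succ_stdGauss {k : ℕ} {Φ : ℝ × ℝ → ℝ≥0∞} (hΦ : Measurable Φ) :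
    ∫⁻ x : Fin (k + 1) → ℝ, Φ (x 0, ∑ i, x i ^ 2) ∂(stdGauss (k + 1)) =
      ∫⁻ y : Fin k → ℝ, ∫⁻ t, Φ (t, t ^ 2 + ∑ i, y i ^ 2) ∂(gaussianReal 0 1) ∂(stdGauss k) := by
  have h := ((measurePreserving_piFinSuccAbove (fun _ : Fin (k + 1) => gaussianReal 0 1) 0).symm)
  rw [stdGauss, ← h.lintegral_comp_emb (MeasurableEquiv.measurableEmbedding _)]
  simp_rw [Fin.sum_univ_succ]
  exact lintegral_prod_symm' (fun p : ℝ × (Fin k → ℝ) => Φ (p.1, p.1 ^ 2 + ∑ i, p.2 i ^ 2))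
    (hΦ.comp (by fun_prop))

lemma lintegral_eq_mul_lintegral_comp_mul {c : ℝ} (hc : 0 < c) {f : ℝ → ℝ≥0∞} (hf : Measurable f) :
    ∫⁻ t, f t = ENNReal.ofReal c * ∫⁻ u, f (c * u) := by
  conv_lhs => rw [← Real.smul_map_volume_mul_left hc.ne']
  rw [lintegral_smul_measure, lintegral_map hf (by fun_prop), abs_of_pos hc, smul_eq_mul]

/-- The Gaussian factor in `u` changes the exponent -W/2 into -ρ²W/2 with ρ² = 1 + u²/k. Rescaling
by `ρ` leaves the mean of the chi distribution and the factor ρ^(-(k+1)): `k` powers from the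
Jacobian, one from the norm. -/
lemma lintegral_stdGauss_kernel {k : ℕ} (hk : 1 ≤ k) (u : ℝ) :
    ∫⁻ y : Fin k → ℝ, ENNReal.ofReal (√((∑ i, y i ^ 2) / k) *
      gaussianPDFReal 0 1 (√((∑ i, y i ^ 2) / k) * u)) ∂(stdGauss k) =
      ENNReal.ofReal (tPDF k u) := by
  have hk0 : (0 : ℝ) < k := by positivity
  have hG := Real.Gamma_pos_of_pos (show (0 : ℝ) < (k : ℝ) / 2 by positivity)
  set ρ : ℝ := √(1 + u ^ 2 / k) with hρ
  have hρ0 : 0 < ρ := by positivity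
  have hρ2 : ρ ^ 2 = 1 + u ^ 2 / k := Real.sq_sqrt (by positivity)
  have hE := lintegral_norm_stdGauss hk
  have hm : Measurable fun y : Fin k → ℝ => gaussianPDFReal 0 1 (√((∑ i, y i ^ 2) / k) * u) :=
    (measurable_gaussianPDFReal 0 1).comp (by fun_prop)
  rw [stdGauss_eq_withDensity, lintegral_withDensity_eq_lintegral_mul _ (by fun_prop)
    (by fun_prop)] at hE ⊢
  set K : ℝ := (√(2 * Real.pi))⁻¹ ^ k
  have hK0 : 0 ≤ K := by positivity
  have key : ∀ y : Fin k → ℝ, ((fun x : Fin k → ℝ =>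
      ENNReal.ofReal (K * Real.exp (-(∑ i, x i ^ 2) / 2))) *
      fun y : Fin k → ℝ => ENNReal.ofReal (√((∑ i, y i ^ 2) / k) *
        gaussianPDFReal 0 1 (√((∑ i, y i ^ 2) / k) * u))) y =
      ENNReal.ofReal ((√k * √(2 * Real.pi) * ρ)⁻¹) *
        ((fun x : Fin k → ℝ => ENNReal.ofReal (K * Real.exp (-(∑ i, x i ^ 2) / 2))) *
          fun x : Fin k → ℝ => ENNReal.ofReal √(∑ i, x i ^ 2)) (fun i => ρ * y i) := by
    intro y
    have hW : 0 ≤ ∑ i, y i ^ 2 := Finset.sum_nonneg fun i _ => sq_nonneg _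
    simp only [Pi.mul_apply]
    simp_rw [mul_pow, ← Finset.mul_sum]
    generalize ∑ i, y i ^ 2 = W at hW
    rw [← ENNReal.ofReal_mul (by positivity), ← ENNReal.ofReal_mul (by positivity),
      ← ENNReal.ofReal_mul (by positivity)]
    congr 1
    have he : Real.exp (-(ρ ^ 2 * W) / 2) =
        Real.exp (-W / 2) * Real.exp (-(√(W / k) * u - 0) ^ 2 / (2 * (1 : ℝ≥0))) := by
      rw [← Real.exp_add, sub_zero, mul_pow, Real.sq_sqrt (show 0 ≤ W / k by positivity), hρ2]
      congr 1
      push_cast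
      field_simp
      ring
    rw [gaussianPDFReal, he, Real.sqrt_mul (sq_nonneg ρ), Real.sqrt_sq hρ0.le,
      Real.sqrt_div hW, NNReal.coe_one, mul_one]
    field_simp
  simp_rw [key]
  rw [lintegral_const_mul _ (by fun_prop), lintegral_comp_const_mul hρ0 (by fun_prop), hE,
    ← ENNReal.ofReal_mul (by positivity), ← ENNReal.ofReal_mul (by positivity), tPDF]
  congr 1
  have h1 : (1 + u ^ 2 / k : ℝ) ^ (-(((k : ℝ) + 1) / 2)) = (ρ ^ k * ρ)⁻¹ := by
    rw [← hρ2, ← pow_succ, Real.rpow_neg (by positivity), ← Real.rpow_natCast,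
      ← Real.rpow_natCast ρ, ← Real.rpow_mul hρ0.le]
    congr 2
    push_cast
    ring
  rw [h1, Real.sqrt_mul hk0.le, Real.sqrt_mul zero_le_two]
  field_simp

/-- The t-statistic of a standard Gaussian sample has Student's t-distribution. -/
theorem lintegral_tStat_stdGauss {k : ℕ} (hk : 1 ≤ k) {G : ℝ → ℝ≥0∞} (hG : Measurable G) :
    ∫⁻ x : Fin (k + 1) → ℝ,
      G (√k * (∑ i, x i) / √(((k : ℝ) + 1) * ∑ i, x i ^ 2 - (∑ i, x i) ^ 2)) ∂(stdGauss (k + 1)) =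
      ∫⁻ u, ENNReal.ofReal (tPDF k u) * G u := by
  have hk0 : (0 : ℝ) < k := by positivity
  have hΦ : Measurable fun p : ℝ × ℝ => G (√k * p.1 / √(((k : ℝ) + 1) * p.2 - p.1 ^ 2)) :=
    hG.comp (by fun_prop)
  rw [lintegral_sum_sumSq_stdGauss (Φ := fun p : ℝ × ℝ =>
    G (√k * p.1 / √(((k : ℝ) + 1) * p.2 - p.1 ^ 2))) hΦ,
    lintegral_succ_stdGauss (Φ := fun p : ℝ × ℝ => G (√k * (√((k : ℝ) + 1) * p.1) /
      √(((k : ℝ) + 1) * p.2 - (√((k : ℝ) + 1) * p.1) ^ 2))) (hG.comp (by fun_prop))]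
  have hm : Measurable fun p : (Fin k → ℝ) × ℝ =>
      gaussianPDFReal 0 1 (√((∑ i, p.1 i ^ 2) / k) * p.2) :=
    (measurable_gaussianPDFReal 0 1).comp (by fun_prop)
  calc _ = ∫⁻ y : Fin k → ℝ, ∫⁻ u, ENNReal.ofReal (√((∑ i, y i ^ 2) / k) *
        gaussianPDFReal 0 1 (√((∑ i, y i ^ 2) / k) * u)) * G u ∂volume ∂(stdGauss k) := by
        refine lintegral_congr_ae ?_
        filter_upwards [(stdGauss_absolutelyContinuous k) (ae_sum_sq_pos hk)]
          with y (hy : 0 < ∑ i, y i ^ 2)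
        generalize ∑ i, y i ^ 2 = W at hy
        have hc : 0 < √(W / k) := by positivity
        -- After the rotation (k+1) V - S² is (k+1) W, with `W` the sum of squares of the other `k`
        -- coordinates.
        have harg : ∀ t : ℝ, √k * (√((k : ℝ) + 1) * t) /
            √(((k : ℝ) + 1) * (t ^ 2 + W) - (√((k : ℝ) + 1) * t) ^ 2) = t / √(W / k) := by
          intro t
          rw [mul_pow, Real.sq_sqrt (by positivity), ← mul_sub, add_sub_cancel_left,
            Real.sqrt_mul (by positivity), Real.sqrt_div hy.le]
          field_simp
        have hGc : Measurable fun t => G (t / √(W / k)) := hG.comp (by fun_prop)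
        simp_rw [harg]
        rw [gaussianReal_of_var_ne_zero 0 one_ne_zero, lintegral_withDensity_eq_lintegral_mul _
          (measurable_gaussianPDF 0 1) hGc,
          lintegral_eq_mul_lintegral_comp_mul hc ((measurable_gaussianPDF 0 1).mul hGc),
          ← lintegral_const_mul]
        · refine lintegral_congr fun u => ?_
          rw [Pi.mul_apply, mul_div_cancel_left₀ _ hc.ne', ENNReal.ofReal_mul hc.le, mul_assoc,
            gaussianPDF]
        · exact ((measurable_gaussianPDF 0 1).mul hGc).comp (by fun_prop)
    _ = ∫⁻ u, ∫⁻ y : Fin k → ℝ, ENNReal.ofReal (√((∑ i, y i ^ 2) / k) *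
        gaussianPDFReal 0 1 (√((∑ i, y i ^ 2) / k) * u)) * G u ∂(stdGauss k) := by
        rw [lintegral_lintegral_swap]
        exact Measurable.aemeasurable (by fun_prop)
    _ = _ := by
        refine lintegral_congr fun u => ?_
        rw [lintegral_mul_const, lintegral_stdGauss_kernel hk]
        exact (Measurable.mul (by fun_prop) (hm.comp (by fun_prop :
          Measurable fun y : Fin k → ℝ => (y, u)))).ennreal_ofReal

/-! ### Lai's interval as a level set of `H` -/

lemma pSum_sub_const {n : ℕ} (hn : 1 ≤ n) (x : ℕ → ℝ) (μ : ℝ) :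
    pSum n (fun i => x i - μ) = n * (avg n x - μ) := by
  have hn0 : (n : ℝ) ≠ 0 := by positivity
  rw [pSum, Finset.sum_sub_distrib, avg, mul_sub, mul_div_cancel₀ _ hn0, pSum]
  simp

lemma pSumSq_sub_const {n : ℕ} (hn : 1 ≤ n) (x : ℕ → ℝ) (μ : ℝ) :
    pSumSq n (fun i => x i - μ) = n * (sampleVar n x + (avg n x - μ) ^ 2) := by
  have hn0 : (n : ℝ) ≠ 0 := by positivity
  have h0 : ∑ i ∈ Finset.range n, (x i - avg n x) = 0 := by
    have := pSum_sub_const hn x (avg n x)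
    rwa [sub_self, mul_zero] at this
  have h1 : ∀ i, (x i - μ) ^ 2 = (x i - avg n x) ^ 2 + 2 * (avg n x - μ) * (x i - avg n x)
      + (avg n x - μ) ^ 2 := fun i => by ring
  rw [pSumSq, sampleVar, mul_add, mul_div_cancel₀ _ hn0]
  simp_rw [h1]
  rw [Finset.sum_add_distrib, Finset.sum_add_distrib, ← Finset.mul_sum, h0]
  simp

lemma sampleVar_nonneg (n : ℕ) (x : ℕ → ℝ) : 0 ≤ sampleVar n x :=
  div_nonneg (Finset.sum_nonneg fun _ _ => sq_nonneg _) (Nat.cast_nonneg n)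

lemma laiB_pos {m : ℕ} (hm : 2 ≤ m) (a : ℝ) : 0 < laiB m a := by
  have h : (0 : ℝ) < (m : ℝ) - 1 := by
    have : (2 : ℝ) ≤ m := by exact_mod_cast hm
    linarith
  have hm0 : (0 : ℝ) < m := by linarith
  rw [laiB]
  positivity

lemma one_le_laiB_mul {m n : ℕ} (hm : 2 ≤ m) (hn : m ≤ n) (a : ℝ) : 1 ≤ laiB m a * n := by
  have h2 : (2 : ℝ) ≤ m := by exact_mod_cast hm
  have hmn : (m : ℝ) ≤ n := by exact_mod_cast hn
  have h : (0 : ℝ) ≤ a ^ 2 / ((m : ℝ) - 1) := div_nonneg (sq_nonneg a) (by linarith)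
  calc (1 : ℝ) ≤ (1 + a ^ 2 / ((m : ℝ) - 1)) ^ m := one_le_pow₀ (by linarith)
    _ = laiB m a * m := by
        rw [laiB]
        field_simp
    _ ≤ laiB m a * n := by
        have := (laiB_pos hm a).le
        gcongr

/-- Lai's interval excludes `μ` exactly when `H`, computed from the centred data, exceeds
`√(2πb)`. -/
theorem notMem_laiCI_iff {m n : ℕ} (hm : 2 ≤ m) (hn : m ≤ n) (a μ : ℝ) (x : ℕ → ℝ) :
    μ ∉ laiCI m a n x ↔
      ENNReal.ofReal √(2 * Real.pi * laiB m a) < tENSM n (fun i => x i - μ) := by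
  have hn0 : (0 : ℝ) < n := by
    have : 0 < n := by omega
    exact_mod_cast this
  have hb := laiB_pos hm a
  have hbn := one_le_laiB_mul hm hn a
  set β : ℝ := (laiB m a * n) ^ (1 / (n : ℝ)) with hβ
  have hβ1 : 1 ≤ β := Real.one_le_rpow hbn (by positivity)
  have hβn : β ^ n = laiB m a * n := by
    rw [hβ, one_div, Real.rpow_inv_natCast_pow (by positivity) (by omega)]
  set d : ℝ := avg n x - μ with hd
  set s : ℝ := sampleVar n x with hs
  have hs0 : 0 ≤ s := sampleVar_nonneg n x
  have hmem : μ ∈ laiCI m a n x ↔ d ^ 2 ≤ s * (β - 1) := by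
    rw [← Real.sqrt_le_sqrt_iff (by nlinarith), Real.sqrt_sq_eq_abs, abs_le, laiCI, Set.mem_Icc,
      laiRadius, ← hβ, ← hs]
    constructor
    · rintro ⟨h1, h2⟩
      constructor <;> linarith
    · rintro ⟨h1, h2⟩
      constructor <;> linarith
  rw [hmem, not_le, tENSM, if_neg (by omega), pSum_sub_const (by omega), pSumSq_sub_const (by omega),
    ← hd, ← hs, show (n : ℝ) * (n * (s + d ^ 2)) - (n * d) ^ 2 = n ^ 2 * s by ring,
    show (n : ℝ) * (n * (s + d ^ 2)) = n ^ 2 * (s + d ^ 2) by ring]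
  have hsq : ENNReal.ofReal (√(2 * Real.pi / n)) ≠ 0 :=
    (ENNReal.ofReal_pos.mpr (by positivity)).ne'
  -- For zero sample variance the interval is the single point `avg n x`. If `μ` is that point the
  -- quotient is 0 / 0 = 0 and `H` vanishes; otherwise `H` is infinite.
  rcases hs0.eq_or_lt with h0 | h0
  · rw [← h0]
    simp only [zero_mul, zero_add, mul_zero, ENNReal.ofReal_zero]
    rcases eq_or_ne d 0 with hd0 | hd0
    · simp [hd0, hn0]
    · rw [ENNReal.div_zero (ENNReal.ofReal_pos.mpr (by positivity)).ne',
        ENNReal.top_rpow_of_pos (by positivity), ENNReal.mul_top hsq]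
      simp only [ENNReal.ofReal_lt_top, iff_true]
      positivity
  · have hq : (n : ℝ) ^ 2 * (s + d ^ 2) / (n ^ 2 * s) = 1 + d ^ 2 / s := by
      field_simp
    have hq0 : 0 < 1 + d ^ 2 / s := by positivity
    -- With everything under one square root the crossing reads b n < (1 + d²/s)ⁿ, and b n = βⁿ by
    -- the choice of `β`.
    have hpow : (1 + d ^ 2 / s) ^ ((n : ℝ) / 2) = √((1 + d ^ 2 / s) ^ n) := by
      rw [Real.sqrt_eq_rpow, ← Real.rpow_natCast (1 + d ^ 2 / s) n, ← Real.rpow_mul hq0.le]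
      congr 1
      ring
    rw [← ENNReal.ofReal_div_of_pos (by positivity), hq, ENNReal.ofReal_rpow_of_pos hq0, hpow,
      ← ENNReal.ofReal_mul (by positivity), ← Real.sqrt_mul (by positivity),
      ENNReal.ofReal_lt_ofReal_iff (by positivity), Real.sqrt_lt_sqrt_iff (by positivity),
      div_mul_eq_mul_div, lt_div_iff₀ hn0, mul_assoc (2 * Real.pi), ← hβn,
      mul_lt_mul_iff_right₀ (by positivity), pow_lt_pow_iff_left₀ (by positivity) hq0.le (by omega),
      ← sub_lt_iff_lt_add', lt_div_iff₀ h0, mul_comm]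

/-! ### The Ville bound as a Student tail -/

lemma ae_card_mul_sumSq_sub_pos {k : ℕ} (hk : 1 ≤ k) :
    ∀ᵐ x ∂(stdGauss (k + 1)), 0 < ((k : ℝ) + 1) * ∑ i, x i ^ 2 - (∑ i, x i) ^ 2 := by
  let N : Set (ℝ × ℝ) := {p | ((k : ℝ) + 1) * p.2 - p.1 ^ 2 ≤ 0}
  have hN : MeasurableSet N := measurableSet_le (by fun_prop) measurable_const
  have hΦ : Measurable (N.indicator fun _ => (1 : ℝ≥0∞)) := measurable_const.indicator hN
  have h1 := lintegral_sum_sumSq_stdGauss (k := k) hΦ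
  rw [lintegral_succ_stdGauss
    (Φ := fun p => N.indicator (fun _ => (1 : ℝ≥0∞)) (√((k : ℝ) + 1) * p.1, p.2))
    (hΦ.comp (by fun_prop))] at h1
  have h2 : ∀ᵐ y ∂(stdGauss k), ∫⁻ t, N.indicator (fun _ => (1 : ℝ≥0∞))
      (√((k : ℝ) + 1) * t, t ^ 2 + ∑ i, y i ^ 2) ∂(gaussianReal 0 1) = 0 := by
    filter_upwards [(stdGauss_absolutelyContinuous k) (ae_sum_sq_pos hk)]
      with y (hy : 0 < ∑ i, y i ^ 2)
    have : ∀ t : ℝ, (√((k : ℝ) + 1) * t, t ^ 2 + ∑ i, y i ^ 2) ∉ N := by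
      intro t
      simp only [N, Set.mem_ofPred_eq, not_le, mul_pow]
      rw [Real.sq_sqrt (by positivity), ← mul_sub, add_sub_cancel_left]
      positivity
    simp [this]
  rw [lintegral_congr_ae h2, lintegral_zero, lintegral_eq_zero_iff
    (f := fun x : Fin (k + 1) → ℝ => N.indicator (fun _ => (1 : ℝ≥0∞)) (∑ i, x i, ∑ i, x i ^ 2))
    (hΦ.comp (by fun_prop))] at h1
  filter_upwards [h1] with x hx
  by_contra hcon
  have hmem : (∑ i, x i, ∑ i, x i ^ 2) ∈ N := not_lt.mp hcon
  simp [hmem] at hx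

/-- The value of `H` as a function of the t-statistic with `k` degrees of freedom. -/
noncomputable def tENSMStat (k : ℕ) (u : ℝ) : ℝ :=
  √(2 * Real.pi / ((k : ℝ) + 1)) * (1 + u ^ 2 / k) ^ (((k : ℝ) + 1) / 2)

/-- With D = (k+1) V - S², the t-statistic satisfies u²/k = S²/D, so the quotient in `H` is 1 +
u²/k. -/
lemma tENSMFin_eq_tENSMStat {k : ℕ} (hk : 1 ≤ k) {x : Fin (k + 1) → ℝ}
    (hx : 0 < ((k : ℝ) + 1) * ∑ i, x i ^ 2 - (∑ i, x i) ^ 2) :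
    tENSMFin (k + 1) x = ENNReal.ofReal (tENSMStat k
      (√k * (∑ i, x i) / √(((k : ℝ) + 1) * ∑ i, x i ^ 2 - (∑ i, x i) ^ 2))) := by
  have hk0 : (0 : ℝ) < k := by positivity
  rw [tENSMFin, if_neg (by omega), tENSMStat]
  push_cast
  generalize hD : ((k : ℝ) + 1) * ∑ i, x i ^ 2 - (∑ i, x i) ^ 2 = D at hx
  have hV : ((k : ℝ) + 1) * ∑ i, x i ^ 2 = D + (∑ i, x i) ^ 2 := by rw [← hD]; ring
  rw [hV, ← ENNReal.ofReal_div_of_pos hx, ENNReal.ofReal_rpow_of_pos (by positivity),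
    ← ENNReal.ofReal_mul (by positivity), div_pow, mul_pow, Real.sq_sqrt hk0.le, Real.sq_sqrt hx.le]
  congr 3
  field_simp

lemma tENSMStat_pos {k : ℕ} (u : ℝ) : 0 < tENSMStat k u := by
  rw [tENSMStat]
  positivity

lemma tENSMStat_lt_iff {k : ℕ} (hk : 1 ≤ k) {a : ℝ} (ha : 0 < a) (u : ℝ) :
    tENSMStat k u < tENSMStat k a ↔ u ∈ Set.Ioo (-a) a := by
  have hk0 : (0 : ℝ) < k := by positivity
  rw [tENSMStat, tENSMStat, mul_lt_mul_iff_right₀ (by positivity),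
    Real.rpow_lt_rpow_iff (by positivity) (by positivity) (by positivity), add_lt_add_iff_left,
    div_lt_div_iff_of_pos_right hk0, sq_lt_sq, abs_of_pos ha, abs_lt, Set.mem_Ioo]

/-- This is the origin of Lai's `b`: the level √(2πb) is the value of `H` at t-statistic `a`. -/
lemma tENSMStat_eq_sqrt_laiB {k : ℕ} (a : ℝ) :
    √(2 * Real.pi * laiB (k + 1) a) = tENSMStat k a := by
  rw [tENSMStat, laiB, show ((k + 1 : ℕ) : ℝ) - 1 = k by push_cast; ring, ← mul_assoc,
    Real.sqrt_mul (by positivity), mul_one_div]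
  push_cast
  congr 1
  rw [Real.sqrt_eq_rpow, ← Real.rpow_natCast, ← Real.rpow_mul (by positivity)]
  congr 1
  push_cast
  ring

lemma tPDF_nonneg {k : ℕ} (hk : 1 ≤ k) (u : ℝ) : 0 ≤ tPDF k u := by
  have hG := Real.Gamma_pos_of_pos (show (0 : ℝ) < (k : ℝ) / 2 by positivity)
  have hG2 := Real.Gamma_pos_of_pos (show (0 : ℝ) < ((k : ℝ) + 1) / 2 by positivity)
  rw [tPDF]
  positivity

/-- The powers of 1 + u²/k cancel, so the Student density is inversely proportional to `H`. -/
lemma tPDF_mul_tENSMStat (k : ℕ) (u a : ℝ) :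
    tPDF k u * tENSMStat k u = tPDF k a * tENSMStat k a := by
  have h : ∀ t : ℝ, (1 + t ^ 2 / k : ℝ) ^ (-(((k : ℝ) + 1) / 2)) *
      (1 + t ^ 2 / k) ^ (((k : ℝ) + 1) / 2) = 1 := fun t => by
    rw [← Real.rpow_add (by positivity), neg_add_cancel, Real.rpow_zero]
  rw [tPDF, tPDF, tENSMStat, tENSMStat, mul_mul_mul_comm, h, mul_mul_mul_comm _ _ _ (_ ^ _), h]

@[fun_prop]
lemma measurable_tPDF (k : ℝ) : Measurable (tPDF k) := by
  unfold tPDF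
  fun_prop

lemma lintegral_tPDF {k : ℕ} (hk : 1 ≤ k) : ∫⁻ u, ENNReal.ofReal (tPDF k u) = 1 := by
  have h := lintegral_tStat_stdGauss hk (G := fun _ => 1) measurable_const
  simpa using h.symm

lemma integrable_tPDF {k : ℕ} (hk : 1 ≤ k) : Integrable (tPDF k) := by
  refine ⟨(measurable_tPDF _).aestronglyMeasurable, ?_⟩
  rw [hasFiniteIntegral_iff_ofReal (Filter.Eventually.of_forall (tPDF_nonneg hk)),
    lintegral_tPDF hk]
  exact ENNReal.one_lt_top

lemma integral_tPDF {k : ℕ} (hk : 1 ≤ k) : ∫ u, tPDF k u = 1 := by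
  rw [integral_eq_lintegral_of_nonneg_ae (Filter.Eventually.of_forall (tPDF_nonneg hk))
    (measurable_tPDF _).aestronglyMeasurable, lintegral_tPDF hk, ENNReal.toReal_one]

lemma lintegral_tPDF_compl_Ioo {k : ℕ} (hk : 1 ≤ k) {a : ℝ} (ha : 0 < a) :
    ∫⁻ u in (Set.Ioo (-a) a)ᶜ, ENNReal.ofReal (tPDF k u) =
      ENNReal.ofReal (2 * (1 - tCDF k a)) := by
  have hint := integrable_tPDF hk
  rw [← ofReal_integral_eq_lintegral_ofReal hint.integrableOn
    (Filter.Eventually.of_forall (tPDF_nonneg hk))]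
  congr 1
  have hset : (Set.Ioo (-a) a)ᶜ = Set.Iic (-a) ∪ Set.Ici a := by
    ext u
    simp only [Set.mem_compl_iff, Set.mem_Ioo, Set.mem_union, Set.mem_Iic, Set.mem_Ici, not_and_or,
      not_lt]
  have hdisj : Disjoint (Set.Iic (-a)) (Set.Ici a) := by
    rw [Set.disjoint_left]
    intro u h1 h2
    simp only [Set.mem_Iic, Set.mem_Ici] at h1 h2
    linarith
  have hneg : ∫ u in Set.Iic (-a), tPDF k u = ∫ u in Set.Ioi a, tPDF k u := by
    have h := integral_comp_neg_Iic (-a) (tPDF k)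
    rw [neg_neg] at h
    rw [← h]
    simp [tPDF]
  have hsplit := intervalIntegral.integral_Iic_add_Ioi (b := a) hint.integrableOn hint.integrableOn
  rw [integral_tPDF hk] at hsplit
  rw [hset, setIntegral_union hdisj measurableSet_Ici hint.integrableOn hint.integrableOn, hneg,
    integral_Ici_eq_integral_Ioi, tCDF]
  linarith

section Law

variable {Ω : Type*} [mΩ : MeasurableSpace Ω] {P : Measure Ω} {X : ℕ → Ω → ℝ} {v : ℝ≥0}

/-- As a single expectation of min(1, M/ε), the bound depends only on the law of `M m`. -/
lemma villeBound_eq_lintegral {M : ℕ → Ω → ℝ≥0∞} {m : ℕ} (hM : Measurable (M m)) (ε : ℝ≥0∞) :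
    villeBound P M m ε = ∫⁻ ω, (if M m ω < ε then ε⁻¹ * M m ω else 1) ∂P := by
  have hs : MeasurableSet {ω | M m ω < ε} := hM measurableSet_Iio
  have hc : {ω | ε ≤ M m ω} = {ω | M m ω < ε}ᶜ := by
    ext ω
    simp
  rw [villeBound, hc, ← lintegral_const_mul _ hM,
    ← lintegral_add_compl (fun ω => if M m ω < ε then ε⁻¹ * M m ω else 1) hs]
  congr 1
  · exact setLIntegral_congr_fun hs fun ω hω => (if_pos hω).symm
  · rw [← setLIntegral_one]
    exact setLIntegral_congr_fun hs.compl fun ω hω => (if_neg hω).symm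

theorem IsIIDGaussian.villeBound_tENSM_eq (h : IsIIDGaussian P X 0 v) (hv : v ≠ 0)
    (hX : ∀ i, Measurable (X i)) {k : ℕ} (hk : 1 ≤ k) {a : ℝ} (ha : 0 < a) :
    villeBound P (fun n ω => tENSM n (fun i => X i ω)) (k + 1) (ENNReal.ofReal (tENSMStat k a)) =
      ENNReal.ofReal (2 * (1 - tCDF k a + a * tPDF k a)) := by
  set ε := ENNReal.ofReal (tENSMStat k a) with hε
  have hε0 : ε ≠ 0 := (ENNReal.ofReal_pos.mpr (tENSMStat_pos a)).ne'
  have hεt : ε ≠ ∞ := ENNReal.ofReal_ne_top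
  let Ψ : ℝ≥0∞ → ℝ≥0∞ := fun t => if t < ε then ε⁻¹ * t else 1
  have hΨ : Measurable Ψ :=
    Measurable.ite measurableSet_Iio (measurable_id.const_mul _) measurable_const
  have hstat : Measurable (tENSMStat k) := by
    unfold tENSMStat
    fun_prop
  have hXm : Measurable (fun ω (i : Fin (k + 1)) => X i ω) := measurable_pi_lambda _ fun i => hX i
  have hM : Measurable fun ω => tENSM (k + 1) (fun i => X i ω) := by
    simp_rw [tENSM_eq_tENSMFin]
    exact (measurable_tENSMFin (k + 1)).comp hXm
  have hA : MeasurableSet (Set.Ioo (-a) a) := measurableSet_Ioo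
  calc _ = ∫⁻ ω, Ψ (tENSMFin (k + 1) (fun i => X i ω)) ∂P := by
        rw [villeBound_eq_lintegral hM]
        simp_rw [tENSM_eq_tENSMFin]
        rfl
    _ = ∫⁻ x, Ψ (tENSMFin (k + 1) x) ∂(stdGauss (k + 1)) :=
        h.lintegral_eq hv hX (g := fun x => Ψ (tENSMFin (k + 1) x))
          (hΨ.comp (measurable_tENSMFin _)) fun c hc x => by rw [tENSMFin_const_mul hc]
    _ = ∫⁻ x : Fin (k + 1) → ℝ, Ψ (ENNReal.ofReal (tENSMStat k
          (√k * (∑ i, x i) / √(((k : ℝ) + 1) * ∑ i, x i ^ 2 - (∑ i, x i) ^ 2))))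
          ∂(stdGauss (k + 1)) := by
        refine lintegral_congr_ae ?_
        filter_upwards [ae_card_mul_sumSq_sub_pos hk] with x hx
        rw [tENSMFin_eq_tENSMStat hk hx]
    _ = ∫⁻ u, ENNReal.ofReal (tPDF k u) * Ψ (ENNReal.ofReal (tENSMStat k u)) :=
        lintegral_tStat_stdGauss hk (G := fun u => Ψ (ENNReal.ofReal (tENSMStat k u)))
          (hΨ.comp hstat.ennreal_ofReal)
    _ = (∫⁻ u in Set.Ioo (-a) a, ENNReal.ofReal (tPDF k a)) +
          ∫⁻ u in (Set.Ioo (-a) a)ᶜ, ENNReal.ofReal (tPDF k u) := by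
        rw [← lintegral_add_compl _ hA]
        congr 1
        -- Below the level, f(u) H(u) / H(a) = f(a).
        · refine setLIntegral_congr_fun hA fun u hu => ?_
          have hlt : ENNReal.ofReal (tENSMStat k u) < ε :=
            (ENNReal.ofReal_lt_ofReal_iff (tENSMStat_pos a)).mpr ((tENSMStat_lt_iff hk ha u).mpr hu)
          simp only [Ψ, if_pos hlt]
          rw [mul_left_comm, ← ENNReal.ofReal_mul (tPDF_nonneg hk u), tPDF_mul_tENSMStat k u a,
            ENNReal.ofReal_mul (tPDF_nonneg hk a), mul_left_comm, ENNReal.inv_mul_cancel hε0 hεt,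
            mul_one]
        · refine setLIntegral_congr_fun hA.compl fun u hu => ?_
          have hlt : ¬ ENNReal.ofReal (tENSMStat k u) < ε := by
            rw [ENNReal.ofReal_lt_ofReal_iff (tENSMStat_pos a), tENSMStat_lt_iff hk ha u]
            exact hu
          simp only [Ψ, if_neg hlt, mul_one]
    _ = _ := by
        have hcdf : 0 ≤ 1 - tCDF k a := by
          rw [sub_nonneg, ← integral_tPDF hk, tCDF]
          exact setIntegral_le_integral (integrable_tPDF hk)
            (Filter.Eventually.of_forall (tPDF_nonneg hk))
        have := tPDF_nonneg hk a
        rw [setLIntegral_const, Real.volume_Ioo, lintegral_tPDF_compl_Ioo hk ha,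
          ← ENNReal.ofReal_mul this, ← ENNReal.ofReal_add
          (mul_nonneg this (by linarith)) (by positivity)]
        congr 1
        ring

end Law

end TTest

theorem mainTheorem3 {Ω : Type*} [MeasurableSpace Ω] (P : Measure Ω) [IsProbabilityMeasure P]
    (X : ℕ → Ω → ℝ) (hX : ∀ i, Measurable (X i)) :
    -- under every `N(0, v)` with `v > 0`
    (∀ v : ℝ≥0, v ≠ 0 → TTest.IsIIDGaussian P X 0 v →
      -- `H` is an extended nonnegative supermartingale on the scale invariant filtration
      TTest.IsENSM P (TTest.scaleInvFiltration X hX) 1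
        (fun n ω => TTest.tENSM n (fun i => X i ω)) ∧
      -- `H` is the flat mixture of the nonnegative martingales `h_θ`, `θ ∈ ℝ`
      (∀ θ : ℝ, TTest.IsNM P (TTest.scaleInvFiltration X hX) 1
        (fun n ω => TTest.tLR θ n (fun i => X i ω))) ∧
      (∀ n : ℕ, 1 ≤ n → ∀ᵐ ω ∂P,
        TTest.tENSM n (fun i => X i ω) = ∫⁻ θ : ℝ, TTest.tLR θ n (fun i => X i ω)) ∧
      -- the extended Ville inequality for `H`
      (∀ m : ℕ, 1 ≤ m → ∀ ε : ℝ≥0∞, ε ≠ 0 → ε ≠ ∞ →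
        P {ω | ∃ n, m ≤ n ∧ ε ≤ TTest.tENSM n (fun i => X i ω)} ≤
          TTest.villeBound P (fun n ω => TTest.tENSM n (fun i => X i ω)) m ε)) ∧
    -- Lai's confidence sequence, under every `N(μ, v)` with `v > 0`
    (∀ (μ : ℝ) (v : ℝ≥0), v ≠ 0 → TTest.IsIIDGaussian P X μ v →
      ∀ (m : ℕ) (a : ℝ), 2 ≤ m → 0 < a →
        -- exclusion of `μ` is the crossing of the level `√(2πb)` by `H` of the centred data
        (∀ (n : ℕ) (ω : Ω), m ≤ n →
          (μ ∉ TTest.laiCI m a n (fun i => X i ω) ↔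
            ENNReal.ofReal (Real.sqrt (2 * Real.pi * TTest.laiB m a)) <
              TTest.tENSM n (fun i => X i ω - μ))) ∧
        -- the bound of the extended Ville inequality at that level
        P {ω | ∃ n, m ≤ n ∧ μ ∉ TTest.laiCI m a n (fun i => X i ω)} ≤
          TTest.villeBound P (fun n ω => TTest.tENSM n (fun i => X i ω - μ)) m
            (ENNReal.ofReal (Real.sqrt (2 * Real.pi * TTest.laiB m a))) ∧
        TTest.villeBound P (fun n ω => TTest.tENSM n (fun i => X i ω - μ)) m
            (ENNReal.ofReal (Real.sqrt (2 * Real.pi * TTest.laiB m a))) ≤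
          ENNReal.ofReal (2 * (1 - TTest.tCDF ((m : ℝ) - 1) a
            + a * TTest.tPDF ((m : ℝ) - 1) a)) ∧
        -- the error bound of Lai's confidence sequence
        P {ω | ∃ n, m ≤ n ∧ μ ∉ TTest.laiCI m a n (fun i => X i ω)} ≤
          ENNReal.ofReal (2 * (1 - TTest.tCDF ((m : ℝ) - 1) a
            + a * TTest.tPDF ((m : ℝ) - 1) a))) := by
  refine ⟨fun v hv h => ?_, fun μ v hv h m a hm ha => ?_⟩
  · have hens := h.isENSM_tENSM hv hX
    exact ⟨hens, h.isNM_tLR hv hX, fun n hn => h.tENSM_eq_lintegral_tLR hv hX hn,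
      fun m hm ε h0 htop => hens.ville hm h0 htop⟩
  · have hY : ∀ i, Measurable fun ω => X i ω - μ := fun i => (hX i).sub_const μ
    have hiff := fun (n : ℕ) (ω : Ω) (hn : m ≤ n) =>
      TTest.notMem_laiCI_iff hm hn a μ (fun i => X i ω)
    have hb := TTest.laiB_pos hm a
    -- The filtration here is the scale invariant one of the centred data, not that of `X`.
    have hville := (h.sub_const.isENSM_tENSM hv hY).ville (m := m) (by omega)
      (ε := ENNReal.ofReal (Real.sqrt (2 * Real.pi * TTest.laiB m a)))
      (ENNReal.ofReal_pos.mpr (by positivity)).ne' ENNReal.ofReal_ne_top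
    have hle : P {ω | ∃ n, m ≤ n ∧ μ ∉ TTest.laiCI m a n (fun i => X i ω)} ≤
        TTest.villeBound P (fun n ω => TTest.tENSM n (fun i => X i ω - μ)) m
          (ENNReal.ofReal (Real.sqrt (2 * Real.pi * TTest.laiB m a))) := by
      refine (measure_mono ?_).trans hville
      rintro ω ⟨n, hn, hω⟩
      exact ⟨n, hn, ((hiff n ω hn).mp hω).le⟩
    have hbound : TTest.villeBound P (fun n ω => TTest.tENSM n (fun i => X i ω - μ)) m
          (ENNReal.ofReal (Real.sqrt (2 * Real.pi * TTest.laiB m a))) =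
        ENNReal.ofReal (2 * (1 - TTest.tCDF ((m : ℝ) - 1) a
          + a * TTest.tPDF ((m : ℝ) - 1) a)) := by
      obtain ⟨k, rfl⟩ : ∃ k, m = k + 1 := ⟨m - 1, by omega⟩
      rw [TTest.tENSMStat_eq_sqrt_laiB, h.sub_const.villeBound_tENSM_eq hv hY (by omega) ha,
        Nat.cast_add, Nat.cast_one, add_sub_cancel_right]
    exact ⟨hiff, hle, hbound.le, hle.trans hbound.le⟩
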